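/- **Setting.** Let $\alpha,\beta:\mathbb N\to\mathbb R$ with $\alpha(x)>0$ for all $x\in\mathbb N=\{0,1,\dots\}$, $\beta(0)=0$ and $\beta(x)>0$ for $x\ge1$. The birth-death process BDP$(\alpha,\beta)$ is the Markov jump process $(X_t)_{t\ge0}$ on $\mathbb N$ that jumps from $x$ to $x+1$ at rate $\alpha(x)$ and from $x$ to $x-1$ at rate $\beta(x)$; $X^x$ denotes the process started at $x$, and $\zeta$ its explosion time. Its semigroup, and its Feynman-Kac semigroup with potential $V:\mathbb N\to\mathbb R$ bounded from below, are $$P_tf(x)=\mathbb E\left[f(X^x_t)\mathbf 1_{\{t<\zeta\}}\right],\qquad P^V_tf(x)=\mathbb E\left[f(X^x_t)\,e^{-\int_0^tV(X^x_s)\,ds}\,\mathbf 1_{\{t<\zeta\}}\right]$$ (the indicator is $1$ almost surely if the process does not explode). Say that rates $(a,b)$ with $a>0$ on $\mathbb N$, $b(0)=0$, $b>0$ on $\{1,2,\dots\}$ satisfy (NE) if $$\sum_{x\ge1}\left(\frac1{a(x)}+\frac{b(x)}{a(x)a(x-1)}+\dots+\frac{b(x)\cdots b(1)}{a(x)\cdots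 a(0)}\right)=\infty$$ (the usual criterion for non-explosion). For a positive sequence $u$ put $\partial_uf(x)=\frac{f(x+1)-f(x)}{u(x)}$, and $\|f\|_\infty=\sup_{x\in\mathbb N}|f(x)|$. For positive sequences $u,v$ on $\mathbb N$ define, for $x\in\mathbb N$ (all terms containing $\beta(0)=0$ being $0$), $$\alpha_u(x)=\tfrac{u(x+1)}{u(x)}\alpha(x+1),\quad \beta_u(x)=\tfrac{u(x-1)}{u(x)}\beta(x),\quad V_u(x)=\alpha(x)-\alpha_u(x)+\beta(x+1)-\beta_u(x),$$ $$\alpha_{u,v}(x)=\tfrac{v(x+1)}{v(x)}\tfrac{u(x+2)}{u(x+1)}\alpha(x+2),\qquad \beta_{u,v}(x)=\tfrac{v(x-1)}{v(x)}\tfrac{u(x-1)}{u(x)}\beta(x),$$ $$V_{u,v}(x)=\alpha(x)-\tfrac{v(x+1)}{v(x)}\tfrac{u(x+2)}{u(x+1)}\alpha(x+2)+\Big(\tfrac{u(x)}{u(x+1)}+1\Big)\beta(x+1)-\Big(1+\tfrac{v(x-1)}{v(x)}\Big)\tfrac{u(x-1)}{u(x)}\beta(x).$$ Let $(P_t)$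 be the semigroup of BDP$(\alpha,\beta)$, and let $(P^{V_{u,v}}_{u,v,t})$ be the Feynman-Kac semigroup of BDP$(\alpha_{u,v},\beta_{u,v})$ with potential $V_{u,v}$. **Theorem.** Assume that $\sum_{x\ge1}\frac{\alpha(0)\cdots\alpha(x-1)}{\beta(1)\cdots\beta(x)}<\infty$, that $(\alpha,\beta)$ and $(\alpha_u,\beta_u)$ satisfy (NE), that $V_u$ is constant on $\mathbb N$ and that $V_{u,v}$ is bounded from below. Then for every $f:\mathbb N\to\mathbb R$ with $\|\partial_uf\|_\infty<\infty$ and $\|\partial_v\partial_uf\|_\infty<\infty$, and every $t\ge0$, the expectations defining $P_tf$ and $P^{V_{u,v}}_{u,v,t}(\partial_v\partial_uf)$ converge absolutely at every point of $\mathbb N$, and $$\partial_v\partial_u(P_tf)=P^{V_{u,v}}_{u,v,t}\left(\partial_v\partial_uf\right).$$ -/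

import Mathlib

open MeasureTheory ProbabilityTheory

namespace BirthDeath

noncomputable section

/-! ### Weighted forward gradients -/

/-- The weighted forward gradient `∂_u f (x) = (f (x + 1) - f x) / u x`. -/
def grad (u f : ℕ → ℝ) (x : ℕ) : ℝ := (f (x + 1) - f x) / u x

/-! ### The birth-death process and its semigroups

The process with birth rates `α` and death rates `β` is built from its embedded jump chain and its
holding times: in state `y` it waits an exponential time of parameter `α y + β y`, and then jumps
to `y + 1` with probability `α y / (α y + β y)` and to `y - 1` with probability
`β y / (α y + β y)`. The birth rates are meant to be positive, the death rates nonnegative,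
and `β 0 = 0`. -/

/-- The law of the randomness used for one jump: a pair of independent variables, a standard
exponential one and a uniform one on `[0, 1]`. -/
def clockLaw : Measure (ℝ × ℝ) := (expMeasure 1).prod (volume.restrict (Set.Icc (0 : ℝ) 1))

instance : IsProbabilityMeasure clockLaw := by
  have h1 : IsProbabilityMeasure (expMeasure 1) := isProbabilityMeasure_expMeasure one_pos
  have h2 : IsProbabilityMeasure (volume.restrict (Set.Icc (0 : ℝ) 1)) := ⟨by simp⟩
  unfold clockLaw
  infer_instance

/-- The law of an i.i.d. sequence of pairs with law `clockLaw`. -/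
def noise : Measure (ℕ → ℝ × ℝ) := Measure.infinitePi fun _ => clockLaw

instance : IsProbabilityMeasure noise := by
  unfold noise
  infer_instance

/-- The embedded jump chain, started at `x`. -/
def chain (α β : ℕ → ℝ) (x : ℕ) (ω : ℕ → ℝ × ℝ) : ℕ → ℕ
  | 0 => x
  | n + 1 =>
    if (ω n).2 * (α (chain α β x ω n) + β (chain α β x ω n)) < α (chain α β x ω n)
    then chain α β x ω n + 1
    else chain α β x ω n - 1

/-- The time spent in the `n`-th visited state. -/
def holdingTime (α β : ℕ → ℝ) (x : ℕ) (ω : ℕ → ℝ × ℝ) (n : ℕ) : ℝ :=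
  (ω n).1 / (α (chain α β x ω n) + β (chain α β x ω n))

/-- The time of the `n`-th jump, with the convention that the `0`-th one is at time `0`. -/
def jumpTime (α β : ℕ → ℝ) (x : ℕ) (ω : ℕ → ℝ × ℝ) (n : ℕ) : ℝ :=
  ∑ k ∈ Finset.range n, holdingTime α β x ω k

/-- The event that the process started at `x` has not exploded up to time `t`. -/
def alive (α β : ℕ → ℝ) (x : ℕ) (t : ℝ) : Set (ℕ → ℝ × ℝ) :=
  {ω | ∃ n, t < jumpTime α β x ω (n + 1)}

/-- The position at time `t ≥ 0` of the process started at `x`, before explosion: it is the `n`-th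
state of the jump chain for `t` between the `n`-th and the `(n + 1)`-st jump time. -/
def path (α β : ℕ → ℝ) (x : ℕ) (t : ℝ) (ω : ℕ → ℝ × ℝ) : ℕ :=
  chain α β x ω (sInf {n | t < jumpTime α β x ω (n + 1)})

/-- The random variable `f (X_t) 1_{t < ζ}`, where `X_0 = x` and `ζ` is the explosion time. -/
def semigroupVar (α β : ℕ → ℝ) (t : ℝ) (f : ℕ → ℝ) (x : ℕ) : (ℕ → ℝ × ℝ) → ℝ :=
  (alive α β x t).indicator fun ω => f (path α β x t ω)

/-- The birth-death semigroup `P_t f (x) = 𝔼[f (X_t) 1_{t < ζ}]`, where `X_0 = x`. -/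
def semigroup (α β : ℕ → ℝ) (t : ℝ) (f : ℕ → ℝ) (x : ℕ) : ℝ :=
  ∫ ω, semigroupVar α β t f x ω ∂noise

/-- The random variable `f (X_t) exp (-∫_0^t V (X_s) ds) 1_{t < ζ}`, where `X_0 = x`. -/
def feynmanKacVar (α β V : ℕ → ℝ) (t : ℝ) (f : ℕ → ℝ) (x : ℕ) : (ℕ → ℝ × ℝ) → ℝ :=
  (alive α β x t).indicator fun ω =>
    f (path α β x t ω) * Real.exp (-∫ s in (0 : ℝ)..t, V (path α β x s ω))

/-- The Feynman-Kac semigroup `P_t^V f (x) = 𝔼[f (X_t) exp (-∫_0^t V (X_s) ds) 1_{t < ζ}]` of the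
birth-death process with rates `(α, β)` and the potential `V`. -/
def feynmanKac (α β V : ℕ → ℝ) (t : ℝ) (f : ℕ → ℝ) (x : ℕ) : ℝ :=
  ∫ ω, feynmanKacVar α β V t f x ω ∂noise

/-! ### Conditions on the rates -/

/-- The ergodicity condition `∑_{x ≥ 1} (α 0 ⋯ α (x - 1)) / (β 1 ⋯ β x) < ∞`. -/
def ErgodicRates (α β : ℕ → ℝ) : Prop :=
  Summable fun x : ℕ => ∏ y ∈ Finset.range (x + 1), α y / β (y + 1)

/-- The non-explosion condition
`∑_{x ≥ 1} (1 / α x + β x / (α x α (x-1)) + ⋯ + (β x ⋯ β 1) / (α x ⋯ α 0)) = ∞`;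
the summands are nonnegative. -/
def NonExplosiveRates (α β : ℕ → ℝ) : Prop :=
  ¬ Summable fun x : ℕ => ∑ k ∈ Finset.range (x + 2),
    (∏ j ∈ Finset.Icc (k + 1) (x + 1), β j) / ∏ j ∈ Finset.Icc k (x + 1), α j

/-! ### First order modified rates and potential -/

/-- `α_u (x) = u (x + 1) / u x * α (x + 1)`. -/
def birth₁ (α u : ℕ → ℝ) (x : ℕ) : ℝ := u (x + 1) / u x * α (x + 1)

/-- `β_u (x) = u (x - 1) / u x * β x` for `x ≥ 1`, and `β_u (0) = 0`. -/
def death₁ (β u : ℕ → ℝ) (x : ℕ) : ℝ := if x = 0 then 0 else u (x - 1) / u x * β x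

/-- `V_u (x) = α x - α_u x + β (x + 1) - β_u x`. -/
def potential₁ (α β u : ℕ → ℝ) (x : ℕ) : ℝ := α x - birth₁ α u x + β (x + 1) - death₁ β u x

/-! ### Second order modified rates and potential -/

/-- `α_{u,v} (x) = v (x + 1) / v x * (u (x + 2) / u (x + 1)) * α (x + 2)`. -/
def birth₂ (α u v : ℕ → ℝ) (x : ℕ) : ℝ :=
  v (x + 1) / v x * (u (x + 2) / u (x + 1)) * α (x + 2)

/-- `β_{u,v} (x) = v (x - 1) / v x * (u (x - 1) / u x) * β x` for `x ≥ 1`, `β_{u,v} (0) = 0`. -/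
def death₂ (β u v : ℕ → ℝ) (x : ℕ) : ℝ :=
  if x = 0 then 0 else v (x - 1) / v x * (u (x - 1) / u x) * β x

/-- The potential `V_{u,v}`; its last term vanishes at `x = 0`. -/
def potential₂ (α β u v : ℕ → ℝ) (x : ℕ) : ℝ :=
  α x - v (x + 1) / v x * (u (x + 2) / u (x + 1)) * α (x + 2)
    + (u x / u (x + 1) + 1) * β (x + 1)
    - (if x = 0 then 0 else (1 + v (x - 1) / v x) * (u (x - 1) / u x) * β x)

end

end BirthDeath

/-!
The second order intertwining is the first order one, used twice: from the rates `(α, β)` with the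
weight `u`, which gives `∂_u P_t f = exp (-c t) P_{u,t} (∂_u f)` when `V_u = c`, and then from the
rates `(α_u, β_u)` with the weight `v`. The rates compose, and `V_{u,v}` is the first order
potential of `(α_u, β_u)` and `v`, plus `c`, so that the exponential factors cancel.

For the first order intertwining (`grad_semigroup_of_bounded`), the forward difference of the
birth-death generator `L` with rates `(a, b)` is `Q` applied to the forward difference, where `Q` is
the tridiagonal operator with upward rates `a (x + 1)`, downward rates `b x` and diagonal
`-(a x + b (x + 1))`. Conjugation of `Q` by the weight gives the generator of the process with the
modified rates, minus the potential. For bounded rates this is an identity between exponentials of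
bounded operators (`expSemigroup_bandOp_succ_sub`). In general, the rates are cut off at `N`, in the
way that reflects the process at `N`:
* the reflected process intertwines exactly with the restriction of `Q` to finitely many states, and
  these restrictions converge to the minimal semigroup of `Q` (`tendsto_differenceGen`);
* the reflected semigroups converge to that of the birth-death process, because they lie between
  two expressions in the semigroup killed at the exit from `{0, …, N}`, and the criterion (NE)
  provides a function `W → ∞` with `L W = 1`, which shows that no mass is lost in the limit
  (`tendsto_killedGen_one`, `tendsto_reflectedGen`).

Minimal semigroups are described by the Picard iterates `picard` of the backward integral equation;
these are the Feynman-Kac expectations over paths with a bounded number of jumps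
(`lintegral_indicator_aliveLt`), by decomposition at the first jump.

For unbounded `f` with bounded gradient and constant `V_u = c`, the function
`U x = ∑_{z < x} u z` satisfies `L U = α 0 * u 0 - c U`. Hence `U`, which dominates `f`, is
integrable, and `f` may be replaced by its truncations `f (min · n)`
(`grad_semigroup_of_potential_const`).
-/

namespace BirthDeath

open Filter Topology
open scoped ENNReal BoundedContinuousFunction

/-! ### Picard iteration for tridiagonal generators -/

/-- The Picard iterates, started at `0`, of the integral equation
`S t x = exp (-d x * t) * f x + ∫_0^t exp (-d x * s) * (p x * S (t-s) (x+1) + m x * S (t-s) (x-1)) ds`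
on nonnegative functions. Their supremum over `n` is the minimal nonnegative solution of the
backward equation of the tridiagonal generator with upward rates `p`, downward rates `m` and
diagonal `-d`. -/
noncomputable def picard (p m d f : ℕ → ℝ) : ℕ → ℝ → ℕ → ℝ≥0∞
  | 0 => fun _ _ => 0
  | n + 1 => fun t x => ENNReal.ofReal (Real.exp (-(d x * t)) * f x) +
      ∫⁻ s in Set.Ioc 0 t, ENNReal.ofReal (Real.exp (-(d x * s))) *
        (ENNReal.ofReal (p x) * picard p m d f n (t - s) (x + 1) +
          ENNReal.ofReal (m x) * picard p m d f n (t - s) (x - 1))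

lemma picard_succ (p m d f : ℕ → ℝ) (n : ℕ) (t : ℝ) (x : ℕ) :
    picard p m d f (n + 1) t x = ENNReal.ofReal (Real.exp (-(d x * t)) * f x) +
      ∫⁻ s in Set.Ioc 0 t, ENNReal.ofReal (Real.exp (-(d x * s))) *
        (ENNReal.ofReal (p x) * picard p m d f n (t - s) (x + 1) +
          ENNReal.ofReal (m x) * picard p m d f n (t - s) (x - 1)) := rfl

/-- Comparison of Picard iterates on `{0, …, N}` when the smaller system cannot leave this set. -/
lemma picard_le_picard_of_cut {p m d p' m' d' f : ℕ → ℝ} (hf : ∀ x, 0 ≤ f x) {N : ℕ}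
    (hp : ∀ x ≤ N, p' x ≤ p x) (hpN : p' N = 0) (hm : ∀ x ≤ N, m' x ≤ m x)
    (hd : ∀ x ≤ N, d x ≤ d' x) (n : ℕ) {t : ℝ} (ht : 0 ≤ t) {x : ℕ} (hx : x ≤ N) :
    picard p' m' d' f n t x ≤ picard p m d f n t x := by
  induction n generalizing t x with
  | zero => exact le_rfl
  | succ n ih =>
    rw [picard_succ, picard_succ]
    refine add_le_add (ENNReal.ofReal_le_ofReal ?_) (setLIntegral_mono' measurableSet_Ioc ?_)
    · exact mul_le_mul_of_nonneg_right
        (Real.exp_le_exp.2 (neg_le_neg (mul_le_mul_of_nonneg_right (hd x hx) ht))) (hf x)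
    · intro s hs
      have hts : 0 ≤ t - s := sub_nonneg.2 hs.2
      refine mul_le_mul' (ENNReal.ofReal_le_ofReal (Real.exp_le_exp.2
        (neg_le_neg (mul_le_mul_of_nonneg_right (hd x hx) hs.1.le)))) (add_le_add ?_ ?_)
      · rcases hx.lt_or_eq with h | rfl
        · exact mul_le_mul' (ENNReal.ofReal_le_ofReal (hp x hx)) (ih hts h)
        · simp [hpN]
      · exact mul_le_mul' (ENNReal.ofReal_le_ofReal (hm x hx)) (ih hts (by omega))

/-- The `n`-th Picard iterate at `x` only sees the coefficients at distance less than `n`. -/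
lemma picard_congr_of_add_le {p m d p' m' d' f : ℕ → ℝ} {N : ℕ}
    (hp : ∀ x < N, p' x = p x) (hm : ∀ x < N, m' x = m x)
    (hd : ∀ x < N, d' x = d x) (n : ℕ) (t : ℝ) {x : ℕ} (hx : x + n ≤ N) :
    picard p' m' d' f n t x = picard p m d f n t x := by
  induction n generalizing t x with
  | zero => rfl
  | succ n ih =>
    have hxN : x < N := by omega
    simp only [picard_succ, hp x hxN, hm x hxN, hd x hxN]
    congr 1
    refine lintegral_congr fun s => ?_
    rw [ih _ (by omega), ih _ (by omega)]

/-- If the coefficients `p N`, `m N`, `d N` agree with `p`, `m`, `d` on `{0, …, N}`, except for the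
upward rate at `N`, which is cut off, then the minimal solutions converge. -/
lemma tendsto_iSup_picard {p m d f : ℕ → ℝ} {p' m' d' : ℕ → ℕ → ℝ} (hf : ∀ x, 0 ≤ f x)
    (hp₀ : ∀ x, 0 ≤ p x) (hp : ∀ N, ∀ x < N, p' N x = p x) (hpN : ∀ N, p' N N = 0)
    (hm : ∀ N, ∀ x ≤ N, m' N x = m x) (hd : ∀ N, ∀ x ≤ N, d' N x = d x)
    {t : ℝ} (ht : 0 ≤ t) (x : ℕ) :
    Tendsto (fun N => ⨆ n, picard (p' N) (m' N) (d' N) f n t x) atTop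
      (𝓝 (⨆ n, picard p m d f n t x)) := by
  refine tendsto_order.2 ⟨fun b hb => ?_, fun b hb => ?_⟩
  · obtain ⟨n, hn⟩ := lt_iSup_iff.1 hb
    filter_upwards [eventually_ge_atTop (x + n)] with N hN
    refine hn.trans_le (le_trans (le_of_eq ?_) (le_iSup _ n))
    exact (picard_congr_of_add_le (fun y hy => hp N y hy) (fun y hy => hm N y hy.le)
      (fun y hy => hd N y hy.le) n t hN).symm
  · filter_upwards [eventually_ge_atTop x] with N hN
    refine lt_of_le_of_lt (iSup_mono fun n => ?_) hb
    refine picard_le_picard_of_cut hf (fun y hy => ?_) (hpN N) (fun y hy => (hm N y hy).le)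
      (fun y hy => (hd N y hy).ge) n ht hN
    rcases hy.lt_or_eq with h | rfl
    · exact (hp N y h).le
    · rw [hpN y]; exact hp₀ y

/-- Conjugation of the generator by a weight `w`, together with a shift of the potential by `c`,
multiplies the minimal solution by `w⁻¹` and by `exp (-c t)`. -/
lemma weight_mul_picard {p m d p' m' d' f f' w : ℕ → ℝ} {c : ℝ} (hw : ∀ x, 0 ≤ w x)
    (hp : ∀ x, w x * p' x = w (x + 1) * p x) (hm : ∀ x, w x * m' x = w (x - 1) * m x)
    (hd : ∀ x, d' x = d x + c) (hf : ∀ x, w x * f' x = f x) (n : ℕ) (t : ℝ) (x : ℕ) :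
    ENNReal.ofReal (w x) * picard p' m' d' f' n t x =
      ENNReal.ofReal (Real.exp (-(c * t))) * picard p m d f n t x := by
  induction n generalizing t x with
  | zero => simp [picard]
  | succ n ih =>
    rw [picard_succ, picard_succ, mul_add, mul_add, ← ENNReal.ofReal_mul (hw x),
      ← ENNReal.ofReal_mul (Real.exp_nonneg _), ← lintegral_const_mul' _ _ ENNReal.ofReal_ne_top,
      ← lintegral_const_mul' _ _ ENNReal.ofReal_ne_top]
    congr 1
    · congr 1
      rw [← hf x, hd x, add_mul, neg_add, Real.exp_add]
      ring
    · refine lintegral_congr fun s => ?_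
      have e1 : ENNReal.ofReal (w x) * (ENNReal.ofReal (p' x) *
          picard p' m' d' f' n (t - s) (x + 1)) = ENNReal.ofReal (Real.exp (-(c * (t - s)))) *
            (ENNReal.ofReal (p x) * picard p m d f n (t - s) (x + 1)) := by
        rw [← mul_assoc, ← ENNReal.ofReal_mul (hw x), hp, ENNReal.ofReal_mul (hw _),
          mul_right_comm, ih, mul_right_comm, mul_assoc]
      have e2 : ENNReal.ofReal (w x) * (ENNReal.ofReal (m' x) *
          picard p' m' d' f' n (t - s) (x - 1)) = ENNReal.ofReal (Real.exp (-(c * (t - s)))) *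
            (ENNReal.ofReal (m x) * picard p m d f n (t - s) (x - 1)) := by
        rw [← mul_assoc, ← ENNReal.ofReal_mul (hw x), hm, ENNReal.ofReal_mul (hw _),
          mul_right_comm, ih, mul_right_comm, mul_assoc]
      rw [mul_left_comm, mul_add (ENNReal.ofReal (w x)), e1, e2, ← mul_add, ← mul_assoc,
        ← mul_assoc, ← ENNReal.ofReal_mul (Real.exp_nonneg _),
        ← ENNReal.ofReal_mul (Real.exp_nonneg _), ← Real.exp_add, ← Real.exp_add, hd x]
      congr 3
      ring

lemma lintegral_Ioc_ofReal_eq {g : ℝ → ℝ} (hg : Continuous g) {t : ℝ} (ht : 0 ≤ t)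
    (h0 : ∀ s ∈ Set.Ioc 0 t, 0 ≤ g s) :
    ∫⁻ s in Set.Ioc 0 t, ENNReal.ofReal (g s) = ENNReal.ofReal (∫ s in (0 : ℝ)..t, g s) := by
  rw [intervalIntegral.integral_of_le ht, ofReal_integral_eq_lintegral_ofReal]
  · exact (hg.intervalIntegrable 0 t).1
  · exact (ae_restrict_iff' measurableSet_Ioc).2 (Eventually.of_forall h0)

/-- A Lyapunov function `W` of the generator, with exponential rate `l`, bounds the minimal
solution. -/
lemma picard_le_of_lyapunov {p m d f W : ℕ → ℝ} {l : ℝ} (hp : ∀ x, 0 ≤ p x) (hm : ∀ x, 0 ≤ m x)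
    (hW : ∀ x, 0 ≤ W x) (hfW : ∀ x, f x ≤ W x)
    (hL : ∀ x, p x * W (x + 1) + m x * W (x - 1) ≤ (l + d x) * W x)
    (n : ℕ) {t : ℝ} (ht : 0 ≤ t) (x : ℕ) :
    picard p m d f n t x ≤ ENNReal.ofReal (Real.exp (l * t) * W x) := by
  induction n generalizing t x with
  | zero => simp [picard]
  | succ n ih =>
    rw [picard_succ]
    set k := l + d x with hk
    have hkW : 0 ≤ k * W x :=
      (add_nonneg (mul_nonneg (hp _) (hW _)) (mul_nonneg (hm _) (hW _))).trans (hL x)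
    have hint : ∫ s in (0 : ℝ)..t, Real.exp (l * t) * (k * W x) * Real.exp (-(k * s)) =
        Real.exp (l * t) * W x * (1 - Real.exp (-(k * t))) := by
      have hder : ∀ s ∈ Set.uIcc 0 t, HasDerivAt
          (fun s => -(Real.exp (l * t) * W x * Real.exp (-(k * s))))
          (Real.exp (l * t) * (k * W x) * Real.exp (-(k * s))) s := by
        intro s _
        have := ((((hasDerivAt_id s).const_mul k).neg).exp.const_mul (Real.exp (l * t) * W x)).neg
        refine this.congr_deriv ?_
        simp
        ring
      rw [intervalIntegral.integral_eq_sub_of_hasDerivAt hder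
        (Continuous.intervalIntegrable (by fun_prop) _ _)]
      simp
      ring
    have hstep : ∫⁻ s in Set.Ioc 0 t, ENNReal.ofReal (Real.exp (-(d x * s))) *
        (ENNReal.ofReal (p x) * picard p m d f n (t - s) (x + 1) +
          ENNReal.ofReal (m x) * picard p m d f n (t - s) (x - 1)) ≤
        ENNReal.ofReal (Real.exp (l * t) * W x * (1 - Real.exp (-(k * t)))) := by
      rw [← hint, ← lintegral_Ioc_ofReal_eq (by fun_prop) ht
        (fun s _ => mul_nonneg (mul_nonneg (Real.exp_nonneg _) hkW) (Real.exp_nonneg _))]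
      refine setLIntegral_mono' measurableSet_Ioc fun s hs => ?_
      have hts : 0 ≤ t - s := sub_nonneg.2 hs.2
      calc _ ≤ ENNReal.ofReal (Real.exp (-(d x * s))) *
            (ENNReal.ofReal (p x) * ENNReal.ofReal (Real.exp (l * (t - s)) * W (x + 1)) +
              ENNReal.ofReal (m x) * ENNReal.ofReal (Real.exp (l * (t - s)) * W (x - 1))) := by
            gcongr <;> exact ih hts _
        _ = ENNReal.ofReal (Real.exp (-(d x * s)) * (Real.exp (l * (t - s)) *
              (p x * W (x + 1) + m x * W (x - 1)))) := by
            rw [← ENNReal.ofReal_mul (hp x), ← ENNReal.ofReal_mul (hm x), ← ENNReal.ofReal_add,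
              ← ENNReal.ofReal_mul (Real.exp_nonneg _)]
            · congr 1; ring
            · exact mul_nonneg (hp _) (mul_nonneg (Real.exp_nonneg _) (hW _))
            · exact mul_nonneg (hm _) (mul_nonneg (Real.exp_nonneg _) (hW _))
        _ ≤ _ := by
            refine ENNReal.ofReal_le_ofReal ?_
            calc _ ≤ Real.exp (-(d x * s)) * (Real.exp (l * (t - s)) * (k * W x)) := by
                  gcongr; exact hL x
              _ = _ := by
                rw [← mul_assoc, ← Real.exp_add, mul_right_comm, ← Real.exp_add]
                congr 2
                rw [hk]; ring
    refine (add_le_add (ENNReal.ofReal_le_ofReal (mul_le_mul_of_nonneg_left (hfW x)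
      (Real.exp_nonneg _))) hstep).trans (le_of_eq ?_)
    have h1 : 0 ≤ 1 - Real.exp (-(k * t)) ∨ W x = 0 := by
      rcases (hW x).lt_or_eq with h | h
      · left
        have : 0 ≤ k := nonneg_of_mul_nonneg_left hkW h
        simp only [sub_nonneg, Real.exp_le_one_iff, neg_nonpos]
        positivity
      · exact Or.inr h.symm
    have h2 : 0 ≤ Real.exp (l * t) * W x * (1 - Real.exp (-(k * t))) := by
      rcases h1 with h | h
      · exact mul_nonneg (mul_nonneg (Real.exp_nonneg _) (hW x)) h
      · simp [h]
    rw [← ENNReal.ofReal_add (mul_nonneg (Real.exp_nonneg _) (hW x)) h2]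
    congr 1
    have : Real.exp (-(d x * t)) = Real.exp (l * t) * Real.exp (-(k * t)) := by
      rw [← Real.exp_add, hk]; congr 1; ring
    rw [this]; ring

/-! ### Exponentials of bounded generators -/

section ExpSemigroup

open NormedSpace

variable {E : Type*} [NormedAddCommGroup E] [NormedSpace ℝ E]

/-- The uniformly continuous semigroup `exp (t A)` of a bounded operator `A`. -/
noncomputable def expSemigroup (A : E →L[ℝ] E) (t : ℝ) : E →L[ℝ] E := exp (t • A)

lemma expSemigroup_zero (A : E →L[ℝ] E) (f : E) : expSemigroup A 0 f = f := by
  simp [expSemigroup]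

variable [CompleteSpace E]

lemma hasDerivAt_expSemigroup (A : E →L[ℝ] E) (f : E) (t : ℝ) :
    HasDerivAt (fun t => expSemigroup A t f) (A (expSemigroup A t f)) t :=
  (ContinuousLinearMap.apply ℝ E f).hasFDerivAt.comp_hasDerivAt t
    (hasDerivAt_exp_smul_const' (𝕂 := ℝ) A t)

lemma hasDerivAt_expSemigroup' (A : E →L[ℝ] E) (f : E) (t : ℝ) :
    HasDerivAt (fun t => expSemigroup A t f) (expSemigroup A t (A f)) t :=
  (ContinuousLinearMap.apply ℝ E f).hasFDerivAt.comp_hasDerivAt t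
    (hasDerivAt_exp_smul_const (𝕂 := ℝ) A t)

lemma hasSum_expSemigroup (A : E →L[ℝ] E) (t : ℝ) (f : E) :
    HasSum (fun n : ℕ => ((n.factorial : ℝ)⁻¹ * t ^ n) • (A ^ n) f) (expSemigroup A t f) := by
  have h := (exp_series_hasSum_exp' (𝕂 := ℝ) (t • A)).mapL (ContinuousLinearMap.apply ℝ E f)
  simpa [expSemigroup, smul_pow, smul_smul] using h

/-- Adding `c` to the generator is undone by the factor `exp (-t c)`. -/
lemma expSemigroup_eq_smul_add (A : E →L[ℝ] E) (c t : ℝ) (f : E) :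
    expSemigroup A t f = Real.exp (-(t * c)) • expSemigroup (A + c • 1) t f := by
  have hdec : t • A = (-(t * c)) • (1 : E →L[ℝ] E) + t • (A + c • (1 : E →L[ℝ] E)) := by
    module
  have hc : exp ((-(t * c)) • (1 : E →L[ℝ] E)) = Real.exp (-(t * c)) • (1 : E →L[ℝ] E) := by
    rw [← Algebra.algebraMap_eq_smul_one, ← Algebra.algebraMap_eq_smul_one,
      ← algebraMap_exp_comm, Real.exp_eq_exp_ℝ]
  let : NormedAlgebra ℚ (E →L[ℝ] E) := NormedAlgebra.restrictScalars ℚ ℝ _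
  rw [expSemigroup, hdec, exp_add_of_commute ((Commute.one_left _).smul_left _), hc]
  simp [expSemigroup]

lemma expSemigroup_apply_of_semiconjBy {T A B : E →L[ℝ] E} (h : SemiconjBy T A B) (t : ℝ) (f : E) :
    T (expSemigroup A t f) = expSemigroup B t (T f) := by
  let : NormedAlgebra ℚ (E →L[ℝ] E) := NormedAlgebra.restrictScalars ℚ ℝ _
  have h1 : SemiconjBy T (t • A) (t • B) := by
    rw [SemiconjBy, mul_smul_comm, smul_mul_assoc, h.eq]
  exact congrArg (fun S : E →L[ℝ] E => S f) h1.exp_right.eq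

end ExpSemigroup

/-! ### Tridiagonal operators on bounded sequences -/

/-- The shift `f ↦ f (· + 1)` on bounded sequences. -/
noncomputable def shiftUp : (ℕ →ᵇ ℝ) →L[ℝ] (ℕ →ᵇ ℝ) :=
  BoundedContinuousFunction.compContinuousCLM ℝ ℝ ⟨fun x : ℕ => x + 1, continuous_of_discreteTopology⟩

/-- The operator `f ↦ f (· - 1)` on bounded sequences, with truncated subtraction. -/
noncomputable def shiftDown : (ℕ →ᵇ ℝ) →L[ℝ] (ℕ →ᵇ ℝ) :=
  BoundedContinuousFunction.compContinuousCLM ℝ ℝ ⟨fun x : ℕ => x - 1, continuous_of_discreteTopology⟩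

@[simp] lemma shiftUp_apply (f : ℕ →ᵇ ℝ) (x : ℕ) : shiftUp f x = f (x + 1) := rfl

@[simp] lemma shiftDown_apply (f : ℕ →ᵇ ℝ) (x : ℕ) : shiftDown f x = f (x - 1) := rfl

/-- The tridiagonal operator `f ↦ p · f (· + 1) + m · f (· - 1) - d · f` on bounded sequences. -/
noncomputable def bandOp (p m d : ℕ →ᵇ ℝ) : (ℕ →ᵇ ℝ) →L[ℝ] (ℕ →ᵇ ℝ) :=
  (ContinuousLinearMap.mul ℝ (ℕ →ᵇ ℝ) p) * shiftUp +
    (ContinuousLinearMap.mul ℝ (ℕ →ᵇ ℝ) m) * shiftDown - ContinuousLinearMap.mul ℝ (ℕ →ᵇ ℝ) d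

@[simp] lemma bandOp_apply (p m d f : ℕ →ᵇ ℝ) (x : ℕ) :
    bandOp p m d f x = p x * f (x + 1) + m x * f (x - 1) - d x * f x := by
  simp [bandOp]

lemma hasDerivAt_expSemigroup_apply (A : (ℕ →ᵇ ℝ) →L[ℝ] (ℕ →ᵇ ℝ)) (f : ℕ →ᵇ ℝ) (x : ℕ) (t : ℝ) :
    HasDerivAt (fun t : ℝ => expSemigroup A t f x) (A (expSemigroup A t f) x) t :=
  (BoundedContinuousFunction.evalCLM ℝ x :
    (ℕ →ᵇ ℝ) →L[ℝ] ℝ).hasFDerivAt.comp_hasDerivAt t (hasDerivAt_expSemigroup A f t)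

lemma expSemigroup_nonneg_of_nonneg {A : (ℕ →ᵇ ℝ) →L[ℝ] (ℕ →ᵇ ℝ)}
    (hA : ∀ f : ℕ →ᵇ ℝ, (∀ x, 0 ≤ f x) → ∀ x, 0 ≤ A f x) {f : ℕ →ᵇ ℝ} (hf : ∀ x, 0 ≤ f x)
    {t : ℝ} (ht : 0 ≤ t) (x : ℕ) : 0 ≤ expSemigroup A t f x := by
  have hpow : ∀ n : ℕ, ∀ x, 0 ≤ (A ^ n) f x := by
    intro n
    induction n with
    | zero => simpa using hf
    | succ n ih =>
      intro x
      rw [pow_succ']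
      exact hA _ ih x
  have h := (hasSum_expSemigroup A t f).mapL (BoundedContinuousFunction.evalCLM ℝ x)
  refine h.nonneg fun n => ?_
  change 0 ≤ ((n.factorial : ℝ)⁻¹ * t ^ n) * (A ^ n) f x
  exact mul_nonneg (by positivity) (hpow n x)

/-- The semigroup of a tridiagonal generator with nonnegative off-diagonal rates preserves
positivity: adding a large multiple of the identity makes the generator positive. -/
lemma expSemigroup_bandOp_nonneg {p m d f : ℕ →ᵇ ℝ} (hp : ∀ x, 0 ≤ p x) (hm : ∀ x, 0 ≤ m x)
    (hf : ∀ x, 0 ≤ f x) {t : ℝ} (ht : 0 ≤ t) (x : ℕ) :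
    0 ≤ expSemigroup (bandOp p m d) t f x := by
  rw [expSemigroup_eq_smul_add (bandOp p m d) ‖d‖]
  refine mul_nonneg (Real.exp_nonneg _) (expSemigroup_nonneg_of_nonneg (fun g hg y => ?_) hf ht x)
  have hdy : d y ≤ ‖d‖ := (le_abs_self _).trans (d.norm_coe_le_norm y)
  change 0 ≤ bandOp p m d g y + ‖d‖ * g y
  rw [bandOp_apply]
  nlinarith [mul_nonneg (hp y) (hg (y + 1)), mul_nonneg (hm y) (hg (y - 1)),
    mul_nonneg (sub_nonneg.2 hdy) (hg y)]

/-- Duhamel's formula, on the diagonal part of the generator. -/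
lemma expSemigroup_bandOp_eq_integral (p m d f : ℕ →ᵇ ℝ) (t : ℝ) (x : ℕ) :
    expSemigroup (bandOp p m d) t f x = Real.exp (-(d x * t)) * f x +
      ∫ s in (0 : ℝ)..t, Real.exp (-(d x * s)) *
        (p x * expSemigroup (bandOp p m d) (t - s) f (x + 1) +
          m x * expSemigroup (bandOp p m d) (t - s) f (x - 1)) := by
  have hy := hasDerivAt_expSemigroup_apply (bandOp p m d) f
  have hcont : ∀ y, Continuous fun t : ℝ => expSemigroup (bandOp p m d) t f y := fun y =>
    continuous_iff_continuousAt.2 fun t => (hy y t).continuousAt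
  have hc2 : ∀ y, Continuous fun s : ℝ => expSemigroup (bandOp p m d) (t - s) f y := fun y =>
    (hcont y).comp (continuous_const.sub continuous_id)
  have hder : ∀ s ∈ Set.uIcc 0 t, HasDerivAt
      (fun s : ℝ => -(Real.exp (-(d x * s)) * expSemigroup (bandOp p m d) (t - s) f x))
      (Real.exp (-(d x * s)) * (p x * expSemigroup (bandOp p m d) (t - s) f (x + 1) +
          m x * expSemigroup (bandOp p m d) (t - s) f (x - 1))) s := by
    intro s _
    have h1 : HasDerivAt (fun s : ℝ => Real.exp (-(d x * s)))
        (Real.exp (-(d x * s)) * (-(d x * 1))) s :=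
      (((hasDerivAt_id s).const_mul (d x)).neg).exp
    have h2 := (hy x (t - s)).comp s ((hasDerivAt_id s).const_sub t)
    refine (h1.mul h2).neg.congr_deriv ?_
    simp only [bandOp_apply, Function.comp]
    simp
    ring
  rw [intervalIntegral.integral_eq_sub_of_hasDerivAt hder
    (Continuous.intervalIntegrable (by
      have := hc2 (x + 1); have := hc2 (x - 1); fun_prop) _ _)]
  simp [expSemigroup_zero]

/-- The same formula in `ℝ≥0∞`: the semigroup solves the fixed point equation of the Picard
iteration. -/
lemma ofReal_expSemigroup_bandOp {p m d f : ℕ →ᵇ ℝ} (hp : ∀ x, 0 ≤ p x) (hm : ∀ x, 0 ≤ m x)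
    (hf : ∀ x, 0 ≤ f x) {t : ℝ} (ht : 0 ≤ t) (x : ℕ) :
    ENNReal.ofReal (expSemigroup (bandOp p m d) t f x) =
      ENNReal.ofReal (Real.exp (-(d x * t)) * f x) +
      ∫⁻ s in Set.Ioc 0 t, ENNReal.ofReal (Real.exp (-(d x * s))) *
        (ENNReal.ofReal (p x) * ENNReal.ofReal (expSemigroup (bandOp p m d) (t - s) f (x + 1)) +
          ENNReal.ofReal (m x) * ENNReal.ofReal (expSemigroup (bandOp p m d) (t - s) f (x - 1))) := by
  have hcont : ∀ y, Continuous fun s : ℝ => expSemigroup (bandOp p m d) (t - s) f y := fun y =>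
    (continuous_iff_continuousAt.2 fun t =>
      (hasDerivAt_expSemigroup_apply (bandOp p m d) f y t).continuousAt).comp
      (continuous_const.sub continuous_id)
  have hpos : ∀ s ∈ Set.Ioc 0 t, ∀ y, 0 ≤ expSemigroup (bandOp p m d) (t - s) f y := fun s hs y =>
    expSemigroup_bandOp_nonneg hp hm hf (sub_nonneg.2 hs.2) y
  have hin : ∀ s ∈ Set.Ioc 0 t, 0 ≤ Real.exp (-(d x * s)) *
        (p x * expSemigroup (bandOp p m d) (t - s) f (x + 1) +
          m x * expSemigroup (bandOp p m d) (t - s) f (x - 1)) := fun s hs =>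
    mul_nonneg (Real.exp_nonneg _) (add_nonneg (mul_nonneg (hp x) (hpos s hs _))
      (mul_nonneg (hm x) (hpos s hs _)))
  rw [expSemigroup_bandOp_eq_integral, ENNReal.ofReal_add (mul_nonneg (Real.exp_nonneg _) (hf x))
    (by
      rw [intervalIntegral.integral_of_le ht]
      exact setIntegral_nonneg measurableSet_Ioc hin), ← lintegral_Ioc_ofReal_eq (by
      have := hcont (x + 1); have := hcont (x - 1); fun_prop) ht hin]
  congr 1
  refine setLIntegral_congr_fun measurableSet_Ioc fun s hs => ?_
  rw [ENNReal.ofReal_mul (Real.exp_nonneg _), ENNReal.ofReal_add (mul_nonneg (hp x) (hpos s hs _))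
      (mul_nonneg (hm x) (hpos s hs _)), ENNReal.ofReal_mul (hp x), ENNReal.ofReal_mul (hm x)]

/-- For bounded rates the minimal solution of the integral equation is the exponential of the
generator. -/
lemma iSup_picard_eq_exp {p m d f : ℕ →ᵇ ℝ} (hp : ∀ x, 0 ≤ p x) (hm : ∀ x, 0 ≤ m x)
    (hd : ∀ x, 0 ≤ d x) (hf : ∀ x, 0 ≤ f x) {t : ℝ} (ht : 0 ≤ t) (x : ℕ) :
    ⨆ n, picard p m d f n t x = ENNReal.ofReal (expSemigroup (bandOp p m d) t f x) := by
  apply le_antisymm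
  · refine iSup_le fun n => ?_
    induction n generalizing t x with
    | zero => exact bot_le
    | succ n ih =>
      rw [picard_succ, ofReal_expSemigroup_bandOp hp hm hf ht]
      refine add_le_add le_rfl (setLIntegral_mono' measurableSet_Ioc fun s hs => ?_)
      have hts : 0 ≤ t - s := sub_nonneg.2 hs.2
      gcongr <;> exact ih hts _
  -- The exponential is bounded on `[0, t]`, and the gap to the `n`-th iterate is divided by `n!`.
  · set K : ℝ := ‖p‖ + ‖m‖ with hK
    have hK0 : 0 ≤ K := by positivity
    obtain ⟨C, hC0, hC⟩ : ∃ C : ℝ, 0 ≤ C ∧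
        ∀ s ∈ Set.Icc 0 t, ∀ y, expSemigroup (bandOp p m d) s f y ≤ C := by
      obtain ⟨C, hC⟩ := (isCompact_Icc (a := (0 : ℝ)) (b := t)).exists_bound_of_continuousOn
        (f := fun s : ℝ => expSemigroup (bandOp p m d) s f)
        (fun s _ => (hasDerivAt_expSemigroup _ f s).continuousAt.continuousWithinAt)
      refine ⟨C, (norm_nonneg _).trans (hC 0 ⟨le_rfl, ht⟩), fun s hs y => ?_⟩
      exact (le_abs_self _).trans ((BoundedContinuousFunction.norm_coe_le_norm _ y).trans (hC s hs))
    have key : ∀ n : ℕ, ∀ s ∈ Set.Icc 0 t, ∀ y, ENNReal.ofReal (expSemigroup (bandOp p m d) s f y) ≤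
        picard p m d f n s y + ENNReal.ofReal (C * (K * s) ^ n / n.factorial) := by
      intro n
      induction n with
      | zero =>
        intro s hs y
        simpa [picard] using ENNReal.ofReal_le_ofReal (hC s hs y)
      | succ n ih =>
        intro r hr y
        have hint : ∫ s in (0 : ℝ)..r, K * (C * (K * (r - s)) ^ n / n.factorial) =
            C * (K * r) ^ (n + 1) / (n + 1).factorial := by
          have hder : ∀ s ∈ Set.uIcc 0 r, HasDerivAt
              (fun s : ℝ => -(C * (K * (r - s)) ^ (n + 1) / (n + 1).factorial))
              (K * (C * (K * (r - s)) ^ n / n.factorial)) s := by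
            intro s _
            have h1 := ((((((hasDerivAt_id s).const_sub r).const_mul K).pow (n + 1)).const_mul
              C).div_const ((n + 1).factorial : ℝ)).neg
            refine h1.congr_deriv ?_
            rw [Nat.factorial_succ]
            push_cast
            simp
            field_simp
          rw [intervalIntegral.integral_eq_sub_of_hasDerivAt hder
            (Continuous.intervalIntegrable (by fun_prop) _ _)]
          simp
        rw [ofReal_expSemigroup_bandOp hp hm hf hr.1, picard_succ, add_assoc, ← hint,
          ← lintegral_Ioc_ofReal_eq (by fun_prop) hr.1 (fun s hs => by
            have : 0 ≤ r - s := sub_nonneg.2 hs.2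
            positivity), ← lintegral_add_right _ (by fun_prop)]
        refine add_le_add le_rfl (setLIntegral_mono' measurableSet_Ioc fun s hs => ?_)
        have hrs : r - s ∈ Set.Icc 0 t := ⟨sub_nonneg.2 hs.2, by linarith [hs.1, hr.2]⟩
        set e : ℝ := C * (K * (r - s)) ^ n / n.factorial with he
        have he0 : 0 ≤ e := by have := hrs.1; positivity
        have hps : p y + m y ≤ K := add_le_add ((le_abs_self _).trans (p.norm_coe_le_norm y))
          ((le_abs_self _).trans (m.norm_coe_le_norm y))
        calc _ ≤ ENNReal.ofReal (Real.exp (-(d y * s))) *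
              (ENNReal.ofReal (p y) * (picard p m d f n (r - s) (y + 1) + ENNReal.ofReal e) +
                ENNReal.ofReal (m y) *
                  (picard p m d f n (r - s) (y - 1) + ENNReal.ofReal e)) := by
              gcongr <;> exact ih _ hrs _
          _ = ENNReal.ofReal (Real.exp (-(d y * s))) *
              (ENNReal.ofReal (p y) * picard p m d f n (r - s) (y + 1) +
                ENNReal.ofReal (m y) * picard p m d f n (r - s) (y - 1)) +
              ENNReal.ofReal (Real.exp (-(d y * s))) * ENNReal.ofReal ((p y + m y) * e) := by
              rw [ENNReal.ofReal_mul (add_nonneg (hp y) (hm y)), ENNReal.ofReal_add (hp y) (hm y)]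
              ring
          _ ≤ _ := by
              refine add_le_add le_rfl ?_
              rw [← ENNReal.ofReal_mul (Real.exp_nonneg _)]
              refine ENNReal.ofReal_le_ofReal ?_
              have h1 : Real.exp (-(d y * s)) ≤ 1 := by
                rw [Real.exp_le_one_iff, neg_nonpos]
                exact mul_nonneg (hd y) hs.1.le
              have h2 : (p y + m y) * e ≤ K * e := mul_le_mul_of_nonneg_right hps he0
              have h3 : 0 ≤ (p y + m y) * e := mul_nonneg (add_nonneg (hp y) (hm y)) he0
              nlinarith
    have hlim : Tendsto (fun n : ℕ => (⨆ n, picard p m d f n t x) +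
        ENNReal.ofReal (C * (K * t) ^ n / n.factorial)) atTop
        (𝓝 ((⨆ n, picard p m d f n t x) + ENNReal.ofReal (C * 0))) := by
      refine tendsto_const_nhds.add (ENNReal.tendsto_ofReal ?_)
      simp_rw [mul_div_assoc]
      exact (FloorSemiring.tendsto_pow_div_factorial_atTop (K * t)).const_mul C
    rw [mul_zero, ENNReal.ofReal_zero, add_zero] at hlim
    exact ge_of_tendsto' hlim fun n =>
      (key n t ⟨ht, le_rfl⟩ x).trans
        (add_le_add (le_iSup (fun n => picard p m d f n t x) n) le_rfl)

/-- The generator `f ↦ a · (f (· + 1) - f) + b · (f (· - 1) - f)` intertwines with the forward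
difference: the difference of the generator is the tridiagonal operator with upward rates
`a (· + 1)`, downward rates `b` and diagonal `-(a + b (· + 1))`, applied to the difference. -/
lemma shiftUp_sub_one_semiconjBy {a b : ℕ →ᵇ ℝ} (hb : b 0 = 0) :
    SemiconjBy (shiftUp - 1) (bandOp a b (a + b)) (bandOp (shiftUp a) b (a + shiftUp b)) := by
  ext f x
  rcases x with _ | x
  · simp [hb]; ring
  · simp; ring

lemma expSemigroup_bandOp_succ_sub {a b : ℕ →ᵇ ℝ} (hb : b 0 = 0) (f : ℕ →ᵇ ℝ) (t : ℝ) (x : ℕ) :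
    expSemigroup (bandOp a b (a + b)) t f (x + 1) - expSemigroup (bandOp a b (a + b)) t f x =
      expSemigroup (bandOp (shiftUp a) b (a + shiftUp b)) t (shiftUp f - f) x :=
  congrArg (fun g : ℕ →ᵇ ℝ => g x) (expSemigroup_apply_of_semiconjBy (shiftUp_sub_one_semiconjBy hb) t f)

/-- The semigroup of a birth-death generator with bounded rates is conservative. -/
lemma expSemigroup_bandOp_one (a b : ℕ →ᵇ ℝ) (t : ℝ) :
    expSemigroup (bandOp a b (a + b)) t 1 = 1 := by
  have h0 : bandOp a b (a + b) 1 = 0 := by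
    ext y; simp
  have hder : ∀ s : ℝ, HasDerivAt (fun s : ℝ => expSemigroup (bandOp a b (a + b)) s 1) 0 s := by
    intro s
    simpa [h0] using hasDerivAt_expSemigroup' (bandOp a b (a + b)) 1 s
  have h := is_const_of_deriv_eq_zero (fun s => (hder s).differentiableAt)
    (fun s => (hder s).deriv) t 0
  simpa [expSemigroup_zero] using h

section Truncation

/-! ### Reflected and killed truncations -/

/-- The sequence equal to `a` on `{0, …, N - 1}` and to `0` elsewhere, as a bounded sequence. -/
noncomputable def restrictLt (N : ℕ) (a : ℕ → ℝ) : ℕ →ᵇ ℝ :=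
  BoundedContinuousFunction.ofNormedAddCommGroupDiscrete (fun x => if x < N then a x else 0)
    (∑ y ∈ Finset.range N, |a y|) fun x => by
      split_ifs with h
      · exact Finset.single_le_sum (f := fun y => |a y|) (fun _ _ => abs_nonneg _)
          (Finset.mem_range.2 h)
      · simpa using Finset.sum_nonneg fun y _ => abs_nonneg (a y)

lemma restrictLt_apply (N : ℕ) (a : ℕ → ℝ) (x : ℕ) :
    restrictLt N a x = if x < N then a x else 0 := rfl

lemma restrictLt_nonneg {a : ℕ → ℝ} (ha : ∀ x, 0 ≤ a x) (N x : ℕ) : 0 ≤ restrictLt N a x := by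
  rw [restrictLt_apply]; split_ifs <;> simp [ha]

/-- The generator of the birth-death process reflected at `N`: the jump from `N` to `N + 1` is
suppressed. -/
noncomputable def reflectedGen (a b : ℕ → ℝ) (N : ℕ) : (ℕ →ᵇ ℝ) →L[ℝ] (ℕ →ᵇ ℝ) :=
  bandOp (restrictLt N a) (restrictLt (N + 1) b) (restrictLt N a + restrictLt (N + 1) b)

/-- The generator of the birth-death process killed when it leaves `{0, …, N}`; all coefficients
outside this set are `0`. -/
noncomputable def killedGen (a b : ℕ → ℝ) (N : ℕ) : (ℕ →ᵇ ℝ) →L[ℝ] (ℕ →ᵇ ℝ) :=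
  bandOp (restrictLt N a) (restrictLt (N + 1) b) (restrictLt (N + 1) (a + b))

/-- The operator that intertwines with `reflectedGen` through the forward difference. -/
noncomputable def differenceGen (a b : ℕ → ℝ) (N : ℕ) : (ℕ →ᵇ ℝ) →L[ℝ] (ℕ →ᵇ ℝ) :=
  bandOp (shiftUp (restrictLt N a)) (restrictLt (N + 1) b)
    (restrictLt N a + shiftUp (restrictLt (N + 1) b))

variable {a b : ℕ → ℝ}

/-- The truncated intertwined semigroups converge to the minimal one. They are applied to a single
function `h`, which need not vanish at infinity: the cut-off rates suppress the jump from `N - 1`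
to `N`, so that the coefficients and the value of `h` at `N` and beyond are not seen. -/
lemma tendsto_differenceGen (ha : ∀ x, 0 ≤ a x) (hb : ∀ x, 0 ≤ b x) {h : ℕ →ᵇ ℝ}
    (hh : ∀ x, 0 ≤ h x) {t : ℝ} (ht : 0 ≤ t) (x : ℕ)
    (hfin : ⨆ n, picard (fun x => a (x + 1)) b (fun x => a x + b (x + 1)) h n t x ≠ ⊤) :
    Tendsto (fun N => expSemigroup (differenceGen a b N) t h x) atTop
      (𝓝 (⨆ n, picard (fun x => a (x + 1)) b (fun x => a x + b (x + 1)) h n t x).toReal) := by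
  -- With rates cut off at `N + 1`, the set `{0, …, N}` is closed for the intertwined operator.
  have key := tendsto_iSup_picard (f := h) (p := fun x => a (x + 1)) (m := b)
    (d := fun x => a x + b (x + 1)) (p' := fun N => shiftUp (restrictLt (N + 1) a))
    (m' := fun N => restrictLt (N + 2) b)
    (d' := fun N => ⇑(restrictLt (N + 1) a + shiftUp (restrictLt (N + 2) b))) hh
    (fun x => ha _) (fun N x hx => by simp [restrictLt_apply, hx])
    (fun N => by simp [restrictLt_apply])
    (fun N x hx => by simp [restrictLt_apply]; intro; omega)
    (fun N x hx => by
      have : x < N + 1 := by omega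
      simp [restrictLt_apply, this]) ht x
  have h2 := (ENNReal.tendsto_toReal hfin).comp key
  refine (tendsto_add_atTop_iff_nat 1).1 (h2.congr fun N => ?_)
  have hpos : ∀ y, 0 ≤ (restrictLt (N + 1) a + shiftUp (restrictLt (N + 2) b) : ℕ →ᵇ ℝ) y :=
    fun y => add_nonneg (restrictLt_nonneg ha _ _) (restrictLt_nonneg hb _ _)
  have hp : ∀ y, 0 ≤ shiftUp (restrictLt (N + 1) a) y := fun y => restrictLt_nonneg ha _ _
  have hm : ∀ y, 0 ≤ restrictLt (N + 2) b y := restrictLt_nonneg hb _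
  simp only [Function.comp]
  rw [iSup_picard_eq_exp hp hm hpos hh ht,
    ENNReal.toReal_ofReal (expSemigroup_bandOp_nonneg hp hm hh ht _), differenceGen]

lemma iSup_picard_le_norm (ha : ∀ x, 0 ≤ a x) (hb : ∀ x, 0 ≤ b x) (g : ℕ →ᵇ ℝ)
    {t : ℝ} (ht : 0 ≤ t) (x : ℕ) :
    ⨆ n, picard a b (a + b) g n t x ≤ ENNReal.ofReal ‖g‖ := by
  refine iSup_le fun n => ?_
  simpa using picard_le_of_lyapunov (p := a) (m := b) (d := a + b) (W := fun _ => ‖g‖) (l := 0)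
    ha hb (fun _ => norm_nonneg _) (fun y => (le_abs_self _).trans (g.norm_coe_le_norm y))
    (fun y => by simp [add_mul]) n ht x

/-- The killed semigroups converge to the minimal one. -/
lemma tendsto_killedGen (ha : ∀ x, 0 ≤ a x) (hb : ∀ x, 0 ≤ b x) {g : ℕ →ᵇ ℝ}
    (hg : ∀ x, 0 ≤ g x) {t : ℝ} (ht : 0 ≤ t) (x : ℕ) :
    Tendsto (fun N => expSemigroup (killedGen a b N) t g x) atTop
      (𝓝 (⨆ n, picard a b (a + b) g n t x).toReal) := by
  have key := tendsto_iSup_picard (f := g) (p := a) (m := b) (d := a + b)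
    (p' := fun N => restrictLt N a) (m' := fun N => restrictLt (N + 1) b)
    (d' := fun N => restrictLt (N + 1) (a + b)) hg ha
    (fun N x hx => by simp [restrictLt_apply, hx])
    (fun N => by simp [restrictLt_apply])
    (fun N x hx => by simp [restrictLt_apply]; intro; omega)
    (fun N x hx => by simp [restrictLt_apply]; intro; omega) ht x
  have h2 := (ENNReal.tendsto_toReal
    (ne_top_of_le_ne_top ENNReal.ofReal_ne_top (iSup_picard_le_norm ha hb g ht x))).comp key
  refine h2.congr fun N => ?_
  simp only [Function.comp]
  rw [iSup_picard_eq_exp (restrictLt_nonneg ha _) (restrictLt_nonneg hb _)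
    (restrictLt_nonneg (a := a + b) (fun y => add_nonneg (ha y) (hb y)) _) hg ht, ENNReal.toReal_ofReal]
  · rfl
  · exact expSemigroup_bandOp_nonneg (restrictLt_nonneg ha _) (restrictLt_nonneg hb _) hg ht _

lemma killedGen_nonneg (ha : ∀ x, 0 ≤ a x) (hb : ∀ x, 0 ≤ b x) {g : ℕ →ᵇ ℝ}
    (hg : ∀ x, 0 ≤ g x) {t : ℝ} (ht : 0 ≤ t) (N x : ℕ) :
    0 ≤ expSemigroup (killedGen a b N) t g x :=
  expSemigroup_bandOp_nonneg (restrictLt_nonneg ha _) (restrictLt_nonneg hb _) hg ht _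

lemma killedGen_le_reflectedGen (ha : ∀ x, 0 ≤ a x) (hb : ∀ x, 0 ≤ b x) {g : ℕ →ᵇ ℝ}
    (hg : ∀ x, 0 ≤ g x) {t : ℝ} (ht : 0 ≤ t) {N x : ℕ} (hx : x ≤ N) :
    expSemigroup (killedGen a b N) t g x ≤ expSemigroup (reflectedGen a b N) t g x := by
  have hR : ∀ y, 0 ≤ (restrictLt N a + restrictLt (N + 1) b : ℕ →ᵇ ℝ) y :=
    fun y => add_nonneg (restrictLt_nonneg ha _ _) (restrictLt_nonneg hb _ _)
  have hpos : 0 ≤ expSemigroup (reflectedGen a b N) t g x :=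
    expSemigroup_bandOp_nonneg (restrictLt_nonneg ha _) (restrictLt_nonneg hb _) hg ht _
  refine (ENNReal.ofReal_le_ofReal_iff hpos).1 ?_
  rw [killedGen, reflectedGen, ← iSup_picard_eq_exp (restrictLt_nonneg ha _)
    (restrictLt_nonneg hb _) (restrictLt_nonneg (a := a + b) (fun y => add_nonneg (ha y) (hb y)) _) hg ht,
    ← iSup_picard_eq_exp (restrictLt_nonneg ha _) (restrictLt_nonneg hb _) hR hg ht]
  refine iSup_mono fun n => picard_le_picard_of_cut hg (fun _ _ => le_rfl)
    (by simp [restrictLt_apply]) (fun _ _ => le_rfl) (fun y hy => ?_) n ht hx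
  have : y < N + 1 := by omega
  simp only [BoundedContinuousFunction.coe_add, Pi.add_apply, restrictLt_apply, this, if_true]
  gcongr
  split_ifs <;> simp [ha]

/-! ### Non-explosion -/

/-- The terms of the series in the non-explosion criterion, including the one at `0`. -/
noncomputable def explosionTerm (a b : ℕ → ℝ) (x : ℕ) : ℝ :=
  ∑ k ∈ Finset.range (x + 1), (∏ j ∈ Finset.Icc (k + 1) x, b j) / ∏ j ∈ Finset.Icc k x, a j

lemma explosionTerm_nonneg (ha : ∀ x, 0 ≤ a x) (hb : ∀ x, 0 ≤ b x) (x : ℕ) :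
    0 ≤ explosionTerm a b x :=
  Finset.sum_nonneg fun _ _ => div_nonneg (Finset.prod_nonneg fun _ _ => hb _)
    (Finset.prod_nonneg fun _ _ => ha _)

lemma mul_explosionTerm_zero (ha : ∀ x, 0 < a x) : a 0 * explosionTerm a b 0 = 1 := by
  simp [explosionTerm, (ha 0).ne']

/-- The recursion that makes `explosionFun` a solution of `L W = 1`. -/
lemma mul_explosionTerm_succ (ha : ∀ x, 0 < a x) (x : ℕ) :
    a (x + 1) * explosionTerm a b (x + 1) = 1 + b (x + 1) * explosionTerm a b x := by
  have ha' := (ha (x + 1)).ne'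
  rw [explosionTerm, Finset.sum_range_succ, mul_add, add_comm, explosionTerm, Finset.mul_sum,
    Finset.mul_sum]
  congr 1
  · simp [ha']
  · refine Finset.sum_congr rfl fun k hk => ?_
    have hk' : k ≤ x := by simpa [Nat.lt_succ_iff] using hk
    have hne : ∏ j ∈ Finset.Icc k x, a j ≠ 0 := Finset.prod_ne_zero_iff.2 fun j _ => (ha j).ne'
    rw [Finset.prod_Icc_succ_top (by omega : k + 1 ≤ x + 1),
      Finset.prod_Icc_succ_top (by omega : k ≤ x + 1)]
    field_simp

/-- The partial sums of `explosionTerm`: a function `W` with `L W = 1` for the generator `L` of the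
birth-death process. -/
noncomputable def explosionFun (a b : ℕ → ℝ) (x : ℕ) : ℝ :=
  ∑ y ∈ Finset.range x, explosionTerm a b y

lemma explosionFun_nonneg (ha : ∀ x, 0 ≤ a x) (hb : ∀ x, 0 ≤ b x) (x : ℕ) :
    0 ≤ explosionFun a b x :=
  Finset.sum_nonneg fun _ _ => explosionTerm_nonneg ha hb _

lemma generator_explosionFun (ha : ∀ x, 0 < a x) (hb₀ : b 0 = 0) (x : ℕ) :
    a x * explosionFun a b (x + 1) + b x * explosionFun a b (x - 1) -
      (a x + b x) * explosionFun a b x = 1 := by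
  rcases x with _ | x
  · simpa [explosionFun, hb₀] using mul_explosionTerm_zero (b := b) ha
  · have h := mul_explosionTerm_succ (b := b) ha x
    simp only [explosionFun, Finset.sum_range_succ, Nat.add_sub_cancel]
    linear_combination h

lemma tendsto_explosionFun (ha : ∀ x, 0 ≤ a x) (hb : ∀ x, 0 ≤ b x)
    (hne : NonExplosiveRates a b) : Tendsto (explosionFun a b) atTop atTop := by
  have h := (not_summable_iff_tendsto_nat_atTop_of_nonneg
    (fun x => explosionTerm_nonneg ha hb (x + 1))).1 hne
  refine (tendsto_add_atTop_iff_nat 1).1 (tendsto_atTop_mono (fun n => ?_) h)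
  rw [explosionFun, Finset.sum_range_succ']
  exact le_add_of_nonneg_right (explosionTerm_nonneg ha hb 0)

/-- Under the non-explosion criterion, the probability that the process stays in `{0, …, N}` up to
time `t` tends to one. With `W = explosionFun`, the function `1 - W / W (N + 1)` vanishes at
`N + 1`, and the killed generator maps it to `-1 / W (N + 1)` on `{0, …, N}`. -/
lemma tendsto_killedGen_one (ha : ∀ x, 0 < a x) (hb₀ : b 0 = 0) (hb : ∀ x, 0 ≤ b x)
    (hne : NonExplosiveRates a b) {t : ℝ} (ht : 0 ≤ t) (x : ℕ) :
    Tendsto (fun N => expSemigroup (killedGen a b N) t 1 x) atTop (𝓝 1) := by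
  have ha0 : ∀ x, 0 ≤ a x := fun x => (ha x).le
  have hle : ∀ N ≥ x, ∀ s, 0 ≤ s → expSemigroup (killedGen a b N) s 1 x ≤ 1 := by
    intro N hN s hs
    refine (killedGen_le_reflectedGen ha0 hb (fun _ => zero_le_one) hs hN).trans ?_
    rw [reflectedGen, expSemigroup_bandOp_one]
    simp
  have hW := tendsto_explosionFun ha0 hb hne
  have hlow : ∀ N ≥ x, 0 < explosionFun a b (N + 1) →
      1 - (explosionFun a b x + t) / explosionFun a b (N + 1) ≤
        expSemigroup (killedGen a b N) t 1 x := by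
    intro N hN hpos
    set w := explosionFun a b (N + 1) with hw
    set k : ℕ →ᵇ ℝ := restrictLt (N + 1) fun y => 1 - explosionFun a b y / w with hk
    have hmono : Monotone (explosionFun a b) := monotone_nat_of_le_succ fun n => by
      rw [explosionFun, explosionFun, Finset.sum_range_succ]
      exact le_add_of_nonneg_right (explosionTerm_nonneg ha0 hb n)
    have hDk : ∀ y, 0 ≤ (killedGen a b N k + w⁻¹ • (1 : ℕ →ᵇ ℝ)) y := by
      intro y
      have hG := generator_explosionFun ha hb₀ y
      simp only [BoundedContinuousFunction.coe_add, Pi.add_apply, killedGen, bandOp_apply,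
        BoundedContinuousFunction.coe_smul, BoundedContinuousFunction.coe_one, Pi.one_apply,
        smul_eq_mul, mul_one, hk, restrictLt_apply]
      by_cases hy : y < N + 1
      · have h1 : y - 1 < N + 1 := by omega
        have h2 : (if y < N then a y else 0) *
            (if y + 1 < N + 1 then 1 - explosionFun a b (y + 1) / w else 0) =
            a y * (1 - explosionFun a b (y + 1) / w) := by
          by_cases hyN : y < N
          · simp [hyN]
          · obtain rfl : y = N := by omega
            simp [← hw, hpos.ne']
        rw [h2]
        simp only [hy, h1, if_true]
        refine le_of_eq ?_
        field_simp
        linear_combination hG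
      · have : ¬ y < N := by omega
        simp [hy, this, hpos.le]
    have hder : ∀ s, HasDerivAt (fun s => expSemigroup (killedGen a b N) s k x + s * w⁻¹)
        (expSemigroup (killedGen a b N) s (killedGen a b N k) x + 1 * w⁻¹) s := fun s =>
      ((BoundedContinuousFunction.evalCLM ℝ x : (ℕ →ᵇ ℝ) →L[ℝ] ℝ).hasFDerivAt.comp_hasDerivAt s
        (hasDerivAt_expSemigroup' _ k s)).add ((hasDerivAt_id s).mul_const _)
    -- The derivative of `exp (s D) k + s / w` is `exp (s D) (D k + 1 / w) + (1 - exp (s D) 1) / w`.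
    have hm : MonotoneOn (fun s => expSemigroup (killedGen a b N) s k x + s * w⁻¹)
        (Set.Ici 0) := by
      refine monotoneOn_of_deriv_nonneg (convex_Ici 0)
        (fun s _ => (hder s).continuousAt.continuousWithinAt)
        (fun s _ => (hder s).differentiableAt.differentiableWithinAt) fun s hs => ?_
      rw [interior_Ici] at hs
      rw [(hder s).deriv]
      have h1 := killedGen_nonneg ha0 hb hDk (le_of_lt hs) N x
      rw [map_add, map_smul] at h1
      have h2 := mul_le_mul_of_nonneg_left (hle N hN s (le_of_lt hs)) (inv_nonneg.2 hpos.le)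
      simp only [BoundedContinuousFunction.coe_add, Pi.add_apply,
        BoundedContinuousFunction.coe_smul, smul_eq_mul] at h1
      linarith
    have h3 := hm (Set.mem_Ici.2 le_rfl) (Set.mem_Ici.2 ht) ht
    simp only [expSemigroup_zero, zero_mul, add_zero] at h3
    have h4 := killedGen_nonneg (g := 1 - k) ha0 hb (fun y => by
      simp only [BoundedContinuousFunction.coe_sub, Pi.sub_apply,
        BoundedContinuousFunction.coe_one, Pi.one_apply, hk, restrictLt_apply]
      split_ifs
      · have := div_nonneg (explosionFun_nonneg ha0 hb y) hpos.le
        linarith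
      · norm_num) ht N x
    rw [map_sub] at h4
    have hkx : k x = 1 - explosionFun a b x / w := by
      have : x < N + 1 := by omega
      simp [hk, restrictLt_apply, this]
    simp only [BoundedContinuousFunction.coe_sub, Pi.sub_apply] at h4
    rw [hkx] at h3
    rw [add_div, div_eq_mul_inv t]
    linarith
  have hlim : Tendsto (fun N => 1 - (explosionFun a b x + t) / explosionFun a b (N + 1)) atTop
      (𝓝 (1 - 0)) :=
    tendsto_const_nhds.sub (tendsto_const_nhds.div_atTop (hW.comp (tendsto_add_atTop_nat 1)))
  rw [sub_zero] at hlim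
  refine tendsto_of_tendsto_of_tendsto_of_le_of_le' hlim tendsto_const_nhds ?_ ?_
  · filter_upwards [eventually_ge_atTop x,
      (hW.comp (tendsto_add_atTop_nat 1)).eventually_gt_atTop 0] with N h1 h2 using hlow N h1 h2
  · filter_upwards [eventually_ge_atTop x] with N hN using hle N hN t ht

/-! ### The intertwining of the minimal semigroups -/

/-- Without explosion, reflection at `N → ∞` does not change the minimal semigroup. -/
lemma tendsto_reflectedGen (ha : ∀ x, 0 < a x) (hb₀ : b 0 = 0) (hb : ∀ x, 0 ≤ b x)
    (hne : NonExplosiveRates a b) {g : ℕ →ᵇ ℝ} (hg : ∀ x, 0 ≤ g x) {t : ℝ} (ht : 0 ≤ t) (x : ℕ) :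
    Tendsto (fun N => expSemigroup (reflectedGen a b N) t g x) atTop
      (𝓝 (⨆ n, picard a b (a + b) g n t x).toReal) := by
  have ha0 : ∀ x, 0 ≤ a x := fun x => (ha x).le
  have h1 := tendsto_killedGen ha0 hb hg ht x
  have h2 : Tendsto (fun N => ‖g‖ - ‖g‖ * expSemigroup (killedGen a b N) t 1 x +
      expSemigroup (killedGen a b N) t g x) atTop
      (𝓝 (‖g‖ - ‖g‖ * 1 + (⨆ n, picard a b (a + b) g n t x).toReal)) :=
    (tendsto_const_nhds.sub ((tendsto_killedGen_one ha hb₀ hb hne ht x).const_mul _)).add h1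
  rw [mul_one, sub_self, zero_add] at h2
  refine tendsto_of_tendsto_of_tendsto_of_le_of_le' h1 h2 ?_ ?_
  · filter_upwards [eventually_ge_atTop x] with N hN
      using killedGen_le_reflectedGen ha0 hb hg ht hN
  · filter_upwards [eventually_ge_atTop x] with N hN
    -- The reflected semigroup is conservative: comparison for `‖g‖ - g` gives the upper bound.
    have h3 := killedGen_le_reflectedGen ha0 hb (g := ‖g‖ • (1 : ℕ →ᵇ ℝ) - g) (fun y => by
      simpa using (le_abs_self _).trans (g.norm_coe_le_norm y)) ht hN
    rw [map_sub, map_sub, map_smul, map_smul] at h3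
    have h4 : expSemigroup (reflectedGen a b N) t 1 x = 1 := by
      rw [reflectedGen, expSemigroup_bandOp_one]; simp
    simp only [BoundedContinuousFunction.coe_sub, Pi.sub_apply,
        BoundedContinuousFunction.coe_smul, smul_eq_mul, h4] at h3
    linarith

/-- The intertwining of the minimal semigroups through the forward difference, for a bounded
function `g = g₁ - g₂` with difference `h = h₁ - h₂`. -/
lemma picard_succ_sub_eq (ha : ∀ x, 0 < a x) (hb₀ : b 0 = 0) (hb : ∀ x, 0 ≤ b x)
    (hne : NonExplosiveRates a b) {g₁ g₂ h₁ h₂ : ℕ →ᵇ ℝ} (hg₁ : ∀ x, 0 ≤ g₁ x)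
    (hg₂ : ∀ x, 0 ≤ g₂ x) (hh₁ : ∀ x, 0 ≤ h₁ x) (hh₂ : ∀ x, 0 ≤ h₂ x)
    (hgh : ∀ x, (g₁ (x + 1) - g₂ (x + 1)) - (g₁ x - g₂ x) = h₁ x - h₂ x)
    {t : ℝ} (ht : 0 ≤ t) (x : ℕ)
    (hfin₁ : ⨆ n, picard (fun x => a (x + 1)) b (fun x => a x + b (x + 1)) h₁ n t x ≠ ⊤)
    (hfin₂ : ⨆ n, picard (fun x => a (x + 1)) b (fun x => a x + b (x + 1)) h₂ n t x ≠ ⊤) :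
    ((⨆ n, picard a b (a + b) g₁ n t (x + 1)).toReal -
      (⨆ n, picard a b (a + b) g₂ n t (x + 1)).toReal) -
      ((⨆ n, picard a b (a + b) g₁ n t x).toReal - (⨆ n, picard a b (a + b) g₂ n t x).toReal) =
    (⨆ n, picard (fun x => a (x + 1)) b (fun x => a x + b (x + 1)) h₁ n t x).toReal -
      (⨆ n, picard (fun x => a (x + 1)) b (fun x => a x + b (x + 1)) h₂ n t x).toReal := by
  have ha0 : ∀ x, 0 ≤ a x := fun x => (ha x).le
  have hl : ∀ y, Tendsto (fun N => expSemigroup (reflectedGen a b N) t (g₁ - g₂) y) atTop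
      (𝓝 ((⨆ n, picard a b (a + b) g₁ n t y).toReal -
        (⨆ n, picard a b (a + b) g₂ n t y).toReal)) := fun y =>
    ((tendsto_reflectedGen ha hb₀ hb hne hg₁ ht y).sub
      (tendsto_reflectedGen ha hb₀ hb hne hg₂ ht y)).congr fun N => by simp
  have hr := (tendsto_differenceGen ha0 hb hh₁ ht x hfin₁).sub
    (tendsto_differenceGen ha0 hb hh₂ ht x hfin₂)
  refine tendsto_nhds_unique ((hl (x + 1)).sub (hl x)) (hr.congr fun N => ?_)
  have e : shiftUp (g₁ - g₂) - (g₁ - g₂) = h₁ - h₂ := by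
    ext y; simpa using hgh y
  rw [reflectedGen, expSemigroup_bandOp_succ_sub (by simp [restrictLt_apply, hb₀]), e,
    differenceGen]
  simp

end Truncation

section Jumps

/-! ### The first jump -/

/-- The noise sequence with first term `q.1` and remaining terms `q.2`. -/
def consNoise (q : (ℝ × ℝ) × (ℕ → ℝ × ℝ)) : ℕ → ℝ × ℝ
  | 0 => q.1
  | n + 1 => q.2 n

lemma measurable_consNoise : Measurable consNoise := by
  refine measurable_pi_iff.2 fun n => ?_
  cases n with
  | zero => exact measurable_fst
  | succ n => exact (measurable_pi_apply n).comp measurable_snd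

/-- An i.i.d. sequence is an independent first term followed by an i.i.d. sequence. -/
lemma map_consNoise : (clockLaw.prod noise).map consNoise = noise := by
  refine Measure.eq_infinitePi _ fun s t ht => ?_
  classical
  set t' : ℕ → Set (ℝ × ℝ) := fun i => if i ∈ s then t i else Set.univ with ht'
  have ht'm : ∀ i, MeasurableSet (t' i) := fun i => by
    rw [ht']; dsimp only; split_ifs; exacts [ht i, MeasurableSet.univ]
  obtain ⟨n, hn⟩ : ∃ n, s ⊆ Finset.range (n + 1) :=
    ⟨s.sup id, fun i hi => Finset.mem_range.2 (Nat.lt_succ_of_le (Finset.le_sup (f := id) hi))⟩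
  have h1 : Set.pi (s : Set ℕ) t = Set.pi (Finset.range (n + 1) : Set ℕ) t' := by
    ext ω
    simp only [Set.mem_pi, ht', Finset.mem_coe]
    constructor
    · intro h i _
      split_ifs with hi
      exacts [h i hi, trivial]
    · intro h i hi
      simpa [hi] using h i (hn hi)
  have h2 : ∏ i ∈ s, clockLaw (t i) = ∏ i ∈ Finset.range (n + 1), clockLaw (t' i) := by
    rw [← Finset.prod_subset hn (f := fun i => clockLaw (t' i)) (fun i _ hi => by simp [ht', hi])]
    exact Finset.prod_congr rfl fun i hi => by simp [ht', hi]
  have h3 : consNoise ⁻¹' Set.pi (Finset.range (n + 1) : Set ℕ) t' =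
      t' 0 ×ˢ Set.pi (Finset.range n : Set ℕ) fun i => t' (i + 1) := by
    ext q
    simp only [Set.mem_preimage, Set.mem_pi, Finset.coe_range, Set.mem_Iio, Set.mem_prod]
    constructor
    · exact fun h => ⟨h 0 n.succ_pos, fun i hi => h (i + 1) (Nat.succ_lt_succ hi)⟩
    · rintro ⟨h0, hs⟩ (_ | i) hi
      exacts [h0, hs i (Nat.lt_of_succ_lt_succ hi)]
  rw [h1, Measure.map_apply measurable_consNoise
    (MeasurableSet.pi (Finset.countable_toSet _) fun i _ => ht'm i), h3, Measure.prod_prod, noise,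
    Measure.infinitePi_pi _ fun i _ => ht'm _, h2, Finset.prod_range_succ', mul_comm]

variable {α β : ℕ → ℝ}

/-- The state of the process started at `x` after its first jump. -/
noncomputable def nextState (α β : ℕ → ℝ) (x : ℕ) (z : ℝ × ℝ) : ℕ :=
  if z.2 * (α x + β x) < α x then x + 1 else x - 1

lemma chain_consNoise (x : ℕ) (z : ℝ × ℝ) (ω : ℕ → ℝ × ℝ) (n : ℕ) :
    chain α β x (consNoise (z, ω)) (n + 1) = chain α β (nextState α β x z) ω n := by
  induction n with
  | zero => rfl
  | succ n ih => rw [chain, ih]; rfl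

lemma jumpTime_consNoise (x : ℕ) (z : ℝ × ℝ) (ω : ℕ → ℝ × ℝ) (n : ℕ) :
    jumpTime α β x (consNoise (z, ω)) (n + 1) =
      jumpTime α β (nextState α β x z) ω n + z.1 / (α x + β x) := by
  rw [jumpTime, Finset.sum_range_succ']
  congr 1
  refine Finset.sum_congr rfl fun k _ => ?_
  rw [holdingTime, chain_consNoise]
  rfl

lemma path_consNoise_of_lt {x : ℕ} {z : ℝ × ℝ} {t : ℝ} (h : t < z.1 / (α x + β x))
    (ω : ℕ → ℝ × ℝ) : path α β x t (consNoise (z, ω)) = x := by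
  have h0 : sInf {n | t < jumpTime α β x (consNoise (z, ω)) (n + 1)} = 0 := by
    refine Nat.sInf_eq_zero.2 (Or.inl ?_)
    rw [Set.mem_ofPred_eq, jumpTime_consNoise]
    simpa [jumpTime] using h
  rw [path, h0, chain]

lemma path_consNoise_of_le {x : ℕ} {z : ℝ × ℝ} {t : ℝ} (h : z.1 / (α x + β x) ≤ t)
    {ω : ℕ → ℝ × ℝ} (hω : ω ∈ alive α β (nextState α β x z) (t - z.1 / (α x + β x))) :
    path α β x t (consNoise (z, ω)) =
      path α β (nextState α β x z) (t - z.1 / (α x + β x)) ω := by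
  have hinf : sInf {n | t < jumpTime α β x (consNoise (z, ω)) (n + 1)} =
      sInf {n | t - z.1 / (α x + β x) < jumpTime α β (nextState α β x z) ω (n + 1)} + 1 := by
    refine IsLeast.csInf_eq ⟨?_, ?_⟩
    · have hne : {n | t - z.1 / (α x + β x) <
          jumpTime α β (nextState α β x z) ω (n + 1)}.Nonempty := hω
      have := Nat.sInf_mem hne
      rw [Set.mem_ofPred_eq] at this ⊢
      rw [jumpTime_consNoise]
      linarith
    · rintro (_ | n) hn
      · rw [Set.mem_ofPred_eq, jumpTime_consNoise] at hn
        simp only [jumpTime, Finset.range_zero, Finset.sum_empty, zero_add] at hn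
        exact absurd hn (not_lt.2 h)
      · rw [Set.mem_ofPred_eq, jumpTime_consNoise] at hn
        exact Nat.succ_le_succ (Nat.sInf_le (by rw [Set.mem_ofPred_eq]; linarith))
  rw [path, hinf, chain_consNoise, path]

/-! ### Measurability -/

lemma measurable_chain (x n : ℕ) : Measurable fun ω => chain α β x ω n := by
  induction n with
  | zero => exact measurable_const
  | succ n ih =>
    have hα : Measurable fun ω => α (chain α β x ω n) := (measurable_of_countable α).comp ih
    have hβ : Measurable fun ω => β (chain α β x ω n) := (measurable_of_countable β).comp ih
    have hω : Measurable fun ω : ℕ → ℝ × ℝ => (ω n).2 := (measurable_pi_apply n).snd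
    exact Measurable.ite (measurableSet_lt (hω.mul (hα.add hβ)) hα)
      ((measurable_of_countable fun k : ℕ => k + 1).comp ih)
      ((measurable_of_countable fun k : ℕ => k - 1).comp ih)

lemma measurable_jumpTime (x n : ℕ) : Measurable fun ω => jumpTime α β x ω n := by
  refine Finset.measurable_sum _ fun k _ => ?_
  have hα : Measurable fun ω => α (chain α β x ω k) :=
    (measurable_of_countable α).comp (measurable_chain x k)
  have hβ : Measurable fun ω => β (chain α β x ω k) :=
    (measurable_of_countable β).comp (measurable_chain x k)
  exact (measurable_pi_apply k).fst.div (hα.add hβ)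

/-- Also covers the points where the set is empty, with the convention `sInf ∅ = 0`. -/
lemma measurable_sInf_setOf {X : Type*} [MeasurableSpace X] {p : ℕ → X → Prop}
    (hp : ∀ n, MeasurableSet {y | p n y}) : Measurable fun y => sInf {n | p n y} := by
  refine measurable_to_countable' fun k => ?_
  have : (fun y => sInf {n | p n y}) ⁻¹' {k} =
      ({y | p k y} ∩ ⋂ j ∈ Set.Iio k, {y | p j y}ᶜ) ∪ ({_y | k = 0} ∩ ⋂ j, {y | p j y}ᶜ) := by
    ext y
    simp only [Set.mem_preimage, Set.mem_singleton_iff, Set.mem_union, Set.mem_inter_iff,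
      Set.mem_ofPred_eq, Set.mem_iInter, Set.mem_compl_iff, Set.mem_Iio]
    constructor
    · rintro rfl
      by_cases hne : {n | p n y}.Nonempty
      · exact Or.inl ⟨Nat.sInf_mem hne, fun j hj => Nat.notMem_of_lt_sInf hj⟩
      · rw [Set.not_nonempty_iff_eq_empty] at hne
        exact Or.inr ⟨by rw [hne, Nat.sInf_empty],
          fun j hj => (Set.mem_empty_iff_false j).1 (hne ▸ hj)⟩
    · rintro (⟨hk, hj⟩ | ⟨rfl, hj⟩)
      · refine IsLeast.csInf_eq ⟨hk, fun j hjm => ?_⟩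
        by_contra hlt
        exact hj j (not_le.1 hlt) hjm
      · have he : {n | p n y} = ∅ := Set.eq_empty_iff_forall_notMem.2 hj
        rw [he, Nat.sInf_empty]
  rw [this]
  refine ((hp k).inter (MeasurableSet.biInter (Set.to_countable _) fun j _ => (hp j).compl)).union
    ((MeasurableSet.const _).inter (MeasurableSet.iInter fun j => (hp j).compl))

lemma measurable_uncurry_path (x : ℕ) :
    Measurable fun q : ℝ × (ℕ → ℝ × ℝ) => path α β x q.1 q.2 := by
  have h1 : Measurable fun q : ℝ × (ℕ → ℝ × ℝ) =>
      sInf {n | q.1 < jumpTime α β x q.2 (n + 1)} :=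
    measurable_sInf_setOf fun n =>
      measurableSet_lt measurable_fst ((measurable_jumpTime x (n + 1)).comp measurable_snd)
  have h2 : Measurable fun r : ℕ × (ℕ → ℝ × ℝ) => chain α β x r.2 r.1 :=
    measurable_from_prod_countable_right fun n => measurable_chain x n
  exact h2.comp (h1.prodMk measurable_snd)

lemma measurable_path (x : ℕ) (t : ℝ) : Measurable (path α β x t) :=
  (measurable_uncurry_path x).comp measurable_prodMk_left

/-- Before explosion, a potential is integrable along the path: only finitely many states are
visited. -/
lemma intervalIntegrable_comp_path (V : ℕ → ℝ) {x : ℕ} {t : ℝ} {ω : ℕ → ℝ × ℝ}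
    (ht : 0 ≤ t) (hω : ω ∈ alive α β x t) :
    IntervalIntegrable (fun s => V (path α β x s ω)) volume 0 t := by
  obtain ⟨K, hK⟩ := hω
  rw [intervalIntegrable_iff_integrableOn_Ioc_of_le ht]
  have hm : Measurable fun s => V (path α β x s ω) :=
    (measurable_of_countable V).comp ((measurable_uncurry_path x).comp measurable_prodMk_right)
  refine Measure.integrableOn_of_bounded (by simp) hm.aestronglyMeasurable
    (M := ∑ k ∈ Finset.range (K + 1), |V (chain α β x ω k)|) ?_
  refine (ae_restrict_iff' measurableSet_Ioc).2 (Eventually.of_forall fun s hs => ?_)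
  refine Finset.single_le_sum (f := fun k => |V (chain α β x ω k)|) (fun _ _ => abs_nonneg _)
    (Finset.mem_range.2 (Nat.lt_succ_of_le (Nat.sInf_le ?_)))
  exact hs.2.trans_lt hK

/-- The event that the process has not exploded up to time `t`, having jumped less than `n`
times. -/
def aliveLt (α β : ℕ → ℝ) (n x : ℕ) (t : ℝ) : Set (ℕ → ℝ × ℝ) :=
  {ω | ∃ k < n, t < jumpTime α β x ω (k + 1)}

lemma aliveLt_subset_alive (n x : ℕ) (t : ℝ) : aliveLt α β n x t ⊆ alive α β x t :=
  fun _ ⟨k, _, hk⟩ => ⟨k, hk⟩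

lemma measurableSet_aliveLt (n x : ℕ) (t : ℝ) : MeasurableSet (aliveLt α β n x t) := by
  have : aliveLt α β n x t = ⋃ k ∈ Set.Iio n, {ω | t < jumpTime α β x ω (k + 1)} := by
    ext ω; simp [aliveLt]
  rw [this]
  exact MeasurableSet.biUnion (Set.to_countable _) fun k _ =>
    measurableSet_lt measurable_const (measurable_jumpTime x _)

lemma measurableSet_alive (x : ℕ) (t : ℝ) : MeasurableSet (alive α β x t) := by
  have : alive α β x t = ⋃ n, aliveLt α β n x t := by
    ext ω
    simp only [alive, aliveLt, Set.mem_ofPred_eq, Set.mem_iUnion]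
    exact ⟨fun ⟨k, hk⟩ => ⟨k + 1, k, k.lt_succ_self, hk⟩, fun ⟨_, k, _, hk⟩ => ⟨k, hk⟩⟩
  rw [this]
  exact MeasurableSet.iUnion fun n => measurableSet_aliveLt n x t

/-- The Feynman-Kac weight times the value of `f` at time `t`, without the indicator. -/
noncomputable def feynmanKacIntegrand (α β V : ℕ → ℝ) (t : ℝ) (f : ℕ → ℝ) (x : ℕ)
    (ω : ℕ → ℝ × ℝ) : ℝ :=
  f (path α β x t ω) * Real.exp (-∫ s in (0 : ℝ)..t, V (path α β x s ω))

lemma measurable_feynmanKacIntegrand (V f : ℕ → ℝ) {t : ℝ} (ht : 0 ≤ t) (x : ℕ) :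
    Measurable (feynmanKacIntegrand α β V t f x) := by
  have hV : Measurable fun q : (ℕ → ℝ × ℝ) × ℝ => V (path α β x q.2 q.1) :=
    (measurable_of_countable V).comp ((measurable_uncurry_path x).comp measurable_swap)
  have hint : Measurable fun ω => ∫ s in (0 : ℝ)..t, V (path α β x s ω) := by
    simp_rw [intervalIntegral.integral_of_le ht]
    exact (StronglyMeasurable.integral_prod_right' (ν := volume.restrict (Set.Ioc 0 t))
      hV.stronglyMeasurable).measurable
  exact ((measurable_of_countable f).comp (measurable_path x t)).mul hint.neg.exp

lemma measurable_feynmanKacVar (V f : ℕ → ℝ) {t : ℝ} (ht : 0 ≤ t) (x : ℕ) :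
    Measurable (feynmanKacVar α β V t f x) :=
  (measurable_feynmanKacIntegrand V f ht x).indicator (measurableSet_alive x t)

/-- Decomposition of the Feynman-Kac functional at the first jump. -/
lemma indicator_aliveLt_succ_consNoise (V f : ℕ → ℝ) {t : ℝ} (ht : 0 ≤ t) (n x : ℕ) {z : ℝ × ℝ}
    (hz : 0 ≤ z.1 / (α x + β x)) (ω : ℕ → ℝ × ℝ) :
    (aliveLt α β (n + 1) x t).indicator (feynmanKacIntegrand α β V t f x) (consNoise (z, ω)) =
      if t < z.1 / (α x + β x) then Real.exp (-(V x * t)) * f x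
      else Real.exp (-(V x * (z.1 / (α x + β x)))) *
        (aliveLt α β n (nextState α β x z) (t - z.1 / (α x + β x))).indicator
          (feynmanKacIntegrand α β V (t - z.1 / (α x + β x)) f (nextState α β x z)) ω := by
  set τ := z.1 / (α x + β x) with hτ
  set y := nextState α β x z with hy
  split_ifs with h
  · have hmem : consNoise (z, ω) ∈ aliveLt α β (n + 1) x t := by
      refine ⟨0, n.succ_pos, ?_⟩
      rw [jumpTime_consNoise]
      simpa [jumpTime] using h
    have hint : ∫ s in (0 : ℝ)..t, V (path α β x s (consNoise (z, ω))) = V x * t := by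
      rw [intervalIntegral.integral_congr (g := fun _ => V x)]
      · simp [mul_comm]
      · intro s hs
        rw [Set.uIcc_of_le ht] at hs
        simp only [path_consNoise_of_lt (hs.2.trans_lt h)]
    rw [Set.indicator_of_mem hmem, feynmanKacIntegrand, hint, path_consNoise_of_lt h, mul_comm]
  · have hle : τ ≤ t := not_lt.1 h
    have hiff : consNoise (z, ω) ∈ aliveLt α β (n + 1) x t ↔ ω ∈ aliveLt α β n y (t - τ) := by
      constructor
      · rintro ⟨_ | k, hk, hk2⟩ <;> rw [jumpTime_consNoise] at hk2
        · simp only [jumpTime, Finset.range_zero, Finset.sum_empty, zero_add] at hk2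
          exact absurd hk2 h
        · exact ⟨k, Nat.lt_of_succ_lt_succ hk, sub_lt_iff_lt_add.2 hk2⟩
      · rintro ⟨k, hk, hk2⟩
        exact ⟨k + 1, Nat.succ_lt_succ hk, by
          rw [jumpTime_consNoise]; exact sub_lt_iff_lt_add.1 hk2⟩
    by_cases hω : ω ∈ aliveLt α β n y (t - τ)
    · have hal := aliveLt_subset_alive _ _ _ hω
      have hali : ∀ s ≤ t, ω ∈ alive α β y (s - τ) := fun s hs => by
        obtain ⟨k, hk⟩ := hal
        exact ⟨k, (sub_le_sub_right hs τ).trans_lt hk⟩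
      have hint1 := intervalIntegrable_comp_path V ht (aliveLt_subset_alive _ _ _ (hiff.2 hω))
      have e1 : ∫ s in (0 : ℝ)..τ, V (path α β x s (consNoise (z, ω))) = V x * τ := by
        rw [intervalIntegral.integral_congr_Ioo_of_le hz (g := fun _ => V x)]
        · simp [mul_comm]
        · intro s hs
          simp only [path_consNoise_of_lt hs.2]
      have e2 : ∫ s in τ..t, V (path α β x s (consNoise (z, ω))) =
          ∫ s in (0 : ℝ)..(t - τ), V (path α β y s ω) := by
        rw [← sub_self τ, ← intervalIntegral.integral_comp_sub_right
          (fun s => V (path α β y s ω)) τ]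
        refine intervalIntegral.integral_congr fun s hs => ?_
        rw [Set.uIcc_of_le hle] at hs
        simp only [path_consNoise_of_le hs.1 (hali s hs.2)]
        rfl
      have e3 := intervalIntegral.integral_add_adjacent_intervals (b := τ)
        (hint1.mono_set (by
          rw [Set.uIcc_of_le hz, Set.uIcc_of_le ht]; exact Set.Icc_subset_Icc le_rfl hle))
        (hint1.mono_set (by
          rw [Set.uIcc_of_le hle, Set.uIcc_of_le ht]; exact Set.Icc_subset_Icc hz le_rfl))
      rw [Set.indicator_of_mem (hiff.2 hω), Set.indicator_of_mem hω, feynmanKacIntegrand,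
        feynmanKacIntegrand, ← e3, e1, e2, path_consNoise_of_le hle (hali t le_rfl), neg_add,
        Real.exp_add]
      ring
    · rw [Set.indicator_of_notMem hω, Set.indicator_of_notMem (fun h => hω (hiff.1 h)), mul_zero]

end Jumps

section FirstJump

/-! ### Integration over the first jump -/

lemma lintegral_expMeasure_one (g : ℝ → ℝ≥0∞) :
    ∫⁻ e, g e ∂(expMeasure 1) = ∫⁻ e in Set.Ioi 0, ENNReal.ofReal (Real.exp (-e)) * g e := by
  have hpdf : expMeasure 1 = volume.withDensity (exponentialPDF 1) := rfl
  have hmeas : Measurable (exponentialPDF 1) := (measurable_exponentialPDFReal 1).ennreal_ofReal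
  rw [hpdf, lintegral_withDensity_eq_lintegral_mul_non_measurable _ hmeas
    (Eventually.of_forall fun _ => ENNReal.ofReal_lt_top), restrict_Ioi_eq_restrict_Ici,
    ← lintegral_indicator measurableSet_Ici]
  refine lintegral_congr fun e => ?_
  by_cases he : 0 ≤ e
  · rw [Set.indicator_of_mem (Set.mem_Ici.2 he), Pi.mul_apply, exponentialPDF_of_nonneg he]
    simp
  · rw [Set.indicator_of_notMem (by simpa using he), Pi.mul_apply,
      exponentialPDF_of_neg (not_le.1 he), zero_mul]

/-- The law of the holding time `e / q`, where `e` is a standard exponential variable. -/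
lemma lintegral_expMeasure_holding {q : ℝ} (hq : 0 < q) {t : ℝ} (ht : 0 ≤ t) (A : ℝ≥0∞)
    (F : ℝ → ℝ≥0∞) :
    ∫⁻ e, (if t < e / q then A else F (e / q)) ∂(expMeasure 1) =
      ENNReal.ofReal (Real.exp (-(q * t))) * A +
        ∫⁻ s in Set.Ioc 0 t, ENNReal.ofReal (Real.exp (-(q * s))) * (ENNReal.ofReal q * F s) := by
  have himg : (fun s : ℝ => q * s) '' Set.Ioi 0 = Set.Ioi 0 := by
    rw [Set.image_mul_left_Ioi hq, mul_zero]
  rw [lintegral_expMeasure_one]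
  conv_lhs => rw [← himg]
  rw [lintegral_image_eq_lintegral_abs_deriv_mul (f' := fun _ => q) measurableSet_Ioi
    (fun s _ => by simpa using ((hasDerivAt_id s).const_mul q).hasDerivWithinAt)
    (fun _ _ _ _ h => mul_left_cancel₀ hq.ne' h)]
  simp only [mul_div_cancel_left₀ _ hq.ne', abs_of_pos hq]
  rw [← Set.Ioc_union_Ioi_eq_Ioi ht, lintegral_union measurableSet_Ioi
    (Set.Ioc_disjoint_Ioi le_rfl), add_comm]
  congr 1
  · rw [setLIntegral_congr_fun (g := fun s => ENNReal.ofReal (q * Real.exp (-q * s)) * A)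
      measurableSet_Ioi (fun s hs => by
        simp only [if_pos (Set.mem_Ioi.1 hs)]
        rw [ENNReal.ofReal_mul hq.le, neg_mul, mul_assoc]),
      lintegral_mul_const _ (by fun_prop), ← ofReal_integral_eq_lintegral_ofReal]
    · rw [integral_const_mul, integral_exp_mul_Ioi (neg_lt_zero.2 hq)]
      congr 2
      field_simp
    · exact (integrableOn_exp_mul_Ioi (neg_lt_zero.2 hq) t).const_mul q
    · exact Eventually.of_forall fun s => by positivity
  · refine setLIntegral_congr_fun measurableSet_Ioc fun s hs => ?_
    simp only [if_neg (not_lt.2 hs.2)]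
    ring

/-- The law of the direction of a jump. -/
lemma lintegral_Icc_ite_mul_lt {p m : ℝ} (hp : 0 < p) (hm : 0 ≤ m) (A B : ℝ≥0∞) :
    ∫⁻ r in Set.Icc (0 : ℝ) 1, (if r * (p + m) < p then A else B) =
      ENNReal.ofReal (p / (p + m)) * A + ENNReal.ofReal (m / (p + m)) * B := by
  have hq : 0 < p + m := by linarith
  have h0 : 0 ≤ p / (p + m) := by positivity
  have h1 : p / (p + m) ≤ 1 := (div_le_one hq).2 (by linarith)
  rw [← Set.Ico_union_Icc_eq_Icc h0 h1, lintegral_union measurableSet_Icc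
    (Set.disjoint_left.2 fun r hr hr' => absurd hr.2 (not_lt.2 hr'.1))]
  congr 1
  · rw [setLIntegral_congr_fun (g := fun _ => A) measurableSet_Ico fun r hr => by
      simp only [if_pos ((lt_div_iff₀ hq).1 hr.2)]]
    simp [mul_comm]
  · rw [setLIntegral_congr_fun (g := fun _ => B) measurableSet_Icc fun r hr => by
      simp only [if_neg (not_lt.2 ((div_le_iff₀ hq).1 hr.1))]]
    have : 1 - p / (p + m) = m / (p + m) := by field_simp; ring
    simp [mul_comm, this]

variable {α β : ℕ → ℝ}

/-- The Picard iterates are the Feynman-Kac expectations restricted to paths with a bounded number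
of jumps. -/
lemma lintegral_indicator_aliveLt (hα : ∀ x, 0 < α x) (hβ : ∀ x, 0 ≤ β x) (V : ℕ → ℝ)
    {f : ℕ → ℝ} (n : ℕ) {t : ℝ} (ht : 0 ≤ t) (x : ℕ) :
    ∫⁻ ω, ENNReal.ofReal ((aliveLt α β n x t).indicator (feynmanKacIntegrand α β V t f x) ω)
      ∂noise = picard α β (α + β + V) f n t x := by
  induction n generalizing t x with
  | zero =>
    have : aliveLt α β 0 x t = ∅ := by ext ω; simp [aliveLt]
    simp [this, picard]
  | succ n ih =>
    have hq : 0 < α x + β x := add_pos_of_pos_of_nonneg (hα x) (hβ x)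
    have hmeas : Measurable fun ω => ENNReal.ofReal
        ((aliveLt α β (n + 1) x t).indicator (feynmanKacIntegrand α β V t f x) ω) :=
      ((measurable_feynmanKacIntegrand V f ht x).indicator
        (measurableSet_aliveLt _ x t)).ennreal_ofReal
    set q := α x + β x with hqdef
    have hin : ∀ e : ℝ, 0 < e → ∀ r : ℝ,
        ∫⁻ ω, ENNReal.ofReal ((aliveLt α β (n + 1) x t).indicator
          (feynmanKacIntegrand α β V t f x) (consNoise ((e, r), ω))) ∂noise =
        if t < e / q then ENNReal.ofReal (Real.exp (-(V x * t)) * f x)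
        else if r * (α x + β x) < α x then ENNReal.ofReal (Real.exp (-(V x * (e / q)))) *
            picard α β (α + β + V) f n (t - e / q) (x + 1)
          else ENNReal.ofReal (Real.exp (-(V x * (e / q)))) *
            picard α β (α + β + V) f n (t - e / q) (x - 1) := by
      intro e he r
      simp_rw [indicator_aliveLt_succ_consNoise V f ht n x (z := (e, r))
        (div_nonneg he.le hq.le)]
      split_ifs with h1 h2
      · simp
      · have hy : nextState α β x (e, r) = x + 1 := if_pos h2
        simp_rw [ENNReal.ofReal_mul (Real.exp_nonneg _)]
        rw [lintegral_const_mul' _ _ ENNReal.ofReal_ne_top, hy, ih (sub_nonneg.2 (not_lt.1 h1))]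
      · have hy : nextState α β x (e, r) = x - 1 := if_neg h2
        simp_rw [ENNReal.ofReal_mul (Real.exp_nonneg _)]
        rw [lintegral_const_mul' _ _ ENNReal.ofReal_ne_top, hy, ih (sub_nonneg.2 (not_lt.1 h1))]
    have hexp : IsProbabilityMeasure (expMeasure 1) := isProbabilityMeasure_expMeasure one_pos
    have hpos : ∀ᵐ e ∂(expMeasure 1), 0 < e := by
      rw [ae_iff, ← lintegral_indicator_one (by measurability), lintegral_expMeasure_one]
      refine (setLIntegral_congr_fun (g := fun _ => 0) measurableSet_Ioi fun e he => ?_).trans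
        (by simp)
      simp [Set.mem_Ioi.1 he]
    have hmeas' : Measurable fun a => ENNReal.ofReal ((aliveLt α β (n + 1) x t).indicator
        (feynmanKacIntegrand α β V t f x) (consNoise a)) := hmeas.comp measurable_consNoise
    rw [← map_consNoise, lintegral_map hmeas measurable_consNoise,
      lintegral_prod _ hmeas'.aemeasurable, clockLaw,
      lintegral_prod _ hmeas'.lintegral_prod_right'.aemeasurable]
    obtain ⟨G, hG⟩ : ∃ G : ℝ → ℝ≥0∞, ∀ s, G s =
        ENNReal.ofReal (α x / q) * (ENNReal.ofReal (Real.exp (-(V x * s))) *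
          picard α β (α + β + V) f n (t - s) (x + 1)) +
        ENNReal.ofReal (β x / q) * (ENNReal.ofReal (Real.exp (-(V x * s))) *
          picard α β (α + β + V) f n (t - s) (x - 1)) := ⟨_, fun _ => rfl⟩
    have hu : ∀ e : ℝ, 0 < e → ∫⁻ r in Set.Icc (0 : ℝ) 1,
        ∫⁻ ω, ENNReal.ofReal ((aliveLt α β (n + 1) x t).indicator
          (feynmanKacIntegrand α β V t f x) (consNoise ((e, r), ω))) ∂noise =
        if t < e / q then ENNReal.ofReal (Real.exp (-(V x * t)) * f x) else G (e / q) := by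
      intro e he
      simp_rw [hin e he, hG]
      split_ifs
      · simp
      · exact lintegral_Icc_ite_mul_lt (hα x) (hβ x) _ _
    rw [lintegral_congr_ae (hpos.mono fun e he => hu e he),
      lintegral_expMeasure_holding hq ht, picard_succ]
    simp_rw [hG]
    congr 1
    · rw [← ENNReal.ofReal_mul (Real.exp_nonneg _), ← mul_assoc, ← Real.exp_add]
      congr 3
      simp only [Pi.add_apply, hqdef]
      ring
    · refine lintegral_congr fun s => ?_
      have e1 : ENNReal.ofReal (Real.exp (-((α + β + V) x * s))) =
          ENNReal.ofReal (Real.exp (-(q * s))) * ENNReal.ofReal (Real.exp (-(V x * s))) := by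
        rw [← ENNReal.ofReal_mul (Real.exp_nonneg _), ← Real.exp_add]
        congr 2
        simp only [Pi.add_apply, hqdef]
        ring
      have e2 : ∀ r, ENNReal.ofReal r = ENNReal.ofReal q * ENNReal.ofReal (r / q) := fun r => by
        rw [← ENNReal.ofReal_mul hq.le, mul_div_cancel₀ _ hq.ne']
      rw [e1, e2 (α x), e2 (β x)]
      ring

/-- The Feynman-Kac expectation of a nonnegative function is the minimal solution of the integral
equation. -/
lemma lintegral_feynmanKacVar (hα : ∀ x, 0 < α x) (hβ : ∀ x, 0 ≤ β x) (V : ℕ → ℝ)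
    (f : ℕ → ℝ) {t : ℝ} (ht : 0 ≤ t) (x : ℕ) :
    ∫⁻ ω, ENNReal.ofReal (feynmanKacVar α β V t f x ω) ∂noise =
      ⨆ n, picard α β (α + β + V) f n t x := by
  have hind : ∀ (s : Set (ℕ → ℝ × ℝ)) ω,
      ENNReal.ofReal (s.indicator (feynmanKacIntegrand α β V t f x) ω) =
        s.indicator (fun ω => ENNReal.ofReal (feynmanKacIntegrand α β V t f x ω)) ω :=
    fun s ω => by
      by_cases h : ω ∈ s <;> simp [h]
  have hmono : Monotone fun n ω => ENNReal.ofReal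
      ((aliveLt α β n x t).indicator (feynmanKacIntegrand α β V t f x) ω) := by
    intro n n' hn ω
    simp only [hind]
    have hsub : aliveLt α β n x t ⊆ aliveLt α β n' x t := by
      rintro ω ⟨k, hk, h⟩
      exact ⟨k, hk.trans_le hn, h⟩
    exact Set.indicator_le_indicator_of_subset hsub (fun _ => bot_le) ω
  simp_rw [← lintegral_indicator_aliveLt hα hβ V _ ht]
  rw [← lintegral_iSup (fun n => ((measurable_feynmanKacIntegrand V f ht x).indicator
    (measurableSet_aliveLt n x t)).ennreal_ofReal) hmono]
  refine lintegral_congr fun ω => le_antisymm ?_ (iSup_le fun n => ?_)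
  · by_cases hω : ω ∈ alive α β x t
    · obtain ⟨k, hk⟩ := hω
      refine le_trans (le_of_eq ?_) (le_iSup _ (k + 1))
      have h1 : ω ∈ aliveLt α β (k + 1) x t := ⟨k, k.lt_succ_self, hk⟩
      rw [Set.indicator_of_mem h1, feynmanKacVar,
        Set.indicator_of_mem (aliveLt_subset_alive _ _ _ h1)]
      rfl
    · rw [feynmanKacVar, Set.indicator_of_notMem hω, ENNReal.ofReal_zero]
      exact bot_le
  · rw [hind]
    by_cases hω : ω ∈ aliveLt α β n x t
    · rw [Set.indicator_of_mem hω, feynmanKacVar,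
        Set.indicator_of_mem (aliveLt_subset_alive _ _ _ hω)]
      rfl
    · rw [Set.indicator_of_notMem hω]
      exact bot_le

end FirstJump

section Intertwining

/-! ### Real-valued semigroups -/

variable {α β V : ℕ → ℝ}

lemma semigroupVar_eq_feynmanKacVar (α β : ℕ → ℝ) (t : ℝ) (f : ℕ → ℝ) (x : ℕ) :
    semigroupVar α β t f x = feynmanKacVar α β 0 t f x := by
  simp [semigroupVar, feynmanKacVar]

lemma semigroup_eq_feynmanKac (α β : ℕ → ℝ) (t : ℝ) (f : ℕ → ℝ) (x : ℕ) :
    semigroup α β t f x = feynmanKac α β 0 t f x := by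
  rw [semigroup, semigroupVar_eq_feynmanKacVar, feynmanKac]

lemma feynmanKacVar_nonneg {f : ℕ → ℝ} (hf : ∀ x, 0 ≤ f x) (t : ℝ) (x : ℕ) (ω : ℕ → ℝ × ℝ) :
    0 ≤ feynmanKacVar α β V t f x ω :=
  Set.indicator_nonneg (fun _ _ => mul_nonneg (hf _) (Real.exp_nonneg _)) ω

lemma abs_feynmanKacVar_le {f : ℕ → ℝ} {C k t : ℝ} (hf : ∀ x, |f x| ≤ C)
    (hV : ∀ x, -k ≤ V x) (ht : 0 ≤ t) (x : ℕ) (ω : ℕ → ℝ × ℝ) :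
    |feynmanKacVar α β V t f x ω| ≤ C * Real.exp (k * t) := by
  have hC : 0 ≤ C := (abs_nonneg _).trans (hf 0)
  rw [feynmanKacVar]
  by_cases hω : ω ∈ alive α β x t
  · rw [Set.indicator_of_mem hω, abs_mul, abs_of_nonneg (Real.exp_nonneg _)]
    refine mul_le_mul (hf _) (Real.exp_le_exp.2 ?_) (Real.exp_nonneg _) hC
    have h := intervalIntegral.integral_mono_on ht (intervalIntegrable_const (c := -k))
      (intervalIntegrable_comp_path V ht hω) (fun s _ => hV (path α β x s ω))
    rw [intervalIntegral.integral_const, sub_zero, smul_eq_mul] at h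
    linarith
  · rw [Set.indicator_of_notMem hω, abs_zero]
    positivity

lemma integrable_feynmanKacVar {f : ℕ → ℝ} {C k t : ℝ} (hf : ∀ x, |f x| ≤ C)
    (hV : ∀ x, -k ≤ V x) (ht : 0 ≤ t) (x : ℕ) :
    Integrable (feynmanKacVar α β V t f x) noise :=
  (integrable_const (C * Real.exp (k * t))).mono'
    (measurable_feynmanKacVar V f ht x).aestronglyMeasurable
    (Eventually.of_forall fun ω => abs_feynmanKacVar_le hf hV ht x ω)

lemma feynmanKac_eq_toReal (hα : ∀ x, 0 < α x) (hβ : ∀ x, 0 ≤ β x) {f : ℕ → ℝ}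
    (hf : ∀ x, 0 ≤ f x) {t : ℝ} (ht : 0 ≤ t) (x : ℕ) :
    feynmanKac α β V t f x = (⨆ n, picard α β (α + β + V) f n t x).toReal := by
  rw [← lintegral_feynmanKacVar hα hβ V f ht x, feynmanKac, integral_eq_lintegral_of_nonneg_ae]
  · exact Eventually.of_forall fun ω => feynmanKacVar_nonneg hf t x ω
  · exact (measurable_feynmanKacVar V f ht x).aestronglyMeasurable

/-- The positive and negative parts are written as maxima with `0`. -/
lemma feynmanKac_eq_sub {f : ℕ → ℝ} {C k t : ℝ} (hf : ∀ x, |f x| ≤ C)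
    (hV : ∀ x, -k ≤ V x) (ht : 0 ≤ t) (x : ℕ) :
    feynmanKac α β V t f x = feynmanKac α β V t (fun y => max (f y) 0) x -
      feynmanKac α β V t (fun y => max (-f y) 0) x := by
  have h1 : ∀ y, |max (f y) 0| ≤ C := fun y => by
    rw [abs_of_nonneg (le_max_right _ _)]
    exact max_le ((le_abs_self _).trans (hf y)) ((abs_nonneg _).trans (hf y))
  have h2 : ∀ y, |max (-f y) 0| ≤ C := fun y => by
    rw [abs_of_nonneg (le_max_right _ _)]
    exact max_le ((neg_le_abs _).trans (hf y)) ((abs_nonneg _).trans (hf y))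
  rw [feynmanKac, feynmanKac, feynmanKac, ← integral_sub (integrable_feynmanKacVar h1 hV ht x)
    (integrable_feynmanKacVar h2 hV ht x)]
  congr 1
  ext ω
  by_cases hω : ω ∈ alive α β x t
  · simp only [feynmanKacVar, Set.indicator_of_mem hω, ← sub_mul]
    congr 1
    rw [max_zero_sub_eq_self]
  · simp [feynmanKacVar, Set.indicator_of_notMem hω]

/-! ### First order intertwining -/

lemma birth₁_pos {a w : ℕ → ℝ} (ha : ∀ x, 0 < a x) (hw : ∀ x, 0 < w x) (x : ℕ) :
    0 < birth₁ a w x :=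
  mul_pos (div_pos (hw _) (hw _)) (ha _)

lemma death₁_nonneg {b w : ℕ → ℝ} (hb : ∀ x, 0 ≤ b x) (hw : ∀ x, 0 < w x) (x : ℕ) :
    0 ≤ death₁ b w x := by
  rw [death₁]
  split_ifs
  exacts [le_rfl, mul_nonneg (div_nonneg (hw _).le (hw _).le) (hb _)]

/-- The minimal solution for the operator that intertwines with the generator through the forward
difference, in terms of the Feynman-Kac expectation of the process with modified rates. -/
lemma iSup_picard_difference {a b w : ℕ → ℝ} {c k : ℝ} (ha : ∀ x, 0 < a x) (hb₀ : b 0 = 0)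
    (hb : ∀ x, 0 ≤ b x) (hw : ∀ x, 0 < w x) (hV : ∀ x, V x = potential₁ a b w x + c)
    (hVk : ∀ x, -k ≤ V x) {f h : ℕ → ℝ} (hf : ∀ x, 0 ≤ f x) {C : ℝ}
    (hfC : ∀ x, |f x| ≤ C) (hfh : ∀ x, w x * f x = h x) {t : ℝ} (ht : 0 ≤ t) (x : ℕ) :
    ⨆ n, picard (fun x => a (x + 1)) b (fun x => a x + b (x + 1)) h n t x ≠ ⊤ ∧
    (⨆ n, picard (fun x => a (x + 1)) b (fun x => a x + b (x + 1)) h n t x).toReal =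
      w x * (Real.exp (c * t) * feynmanKac (birth₁ a w) (death₁ b w) V t f x) := by
  have hscale : ∀ n, ENNReal.ofReal (w x) *
      picard (birth₁ a w) (death₁ b w) (birth₁ a w + death₁ b w + V) f n t x =
      ENNReal.ofReal (Real.exp (-(c * t))) *
        picard (fun x => a (x + 1)) b (fun x => a x + b (x + 1)) h n t x := fun n => by
    refine weight_mul_picard (fun y => (hw y).le) (fun y => ?_) (fun y => ?_) (fun y => ?_) hfh
      n t x
    · have := (hw y).ne'
      rw [birth₁]; field_simp
    · have := (hw y).ne'
      rw [death₁]
      split_ifs with hy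
      · simp [hy, hb₀]
      · field_simp
    · simp only [Pi.add_apply, hV, potential₁]
      ring
  set Q := ⨆ n, picard (fun x => a (x + 1)) b (fun x => a x + b (x + 1)) h n t x with hQ
  have hsup : ENNReal.ofReal (w x) *
      (⨆ n, picard (birth₁ a w) (death₁ b w) (birth₁ a w + death₁ b w + V) f n t x) =
      ENNReal.ofReal (Real.exp (-(c * t))) * Q := by
    rw [hQ, ENNReal.mul_iSup, ENNReal.mul_iSup]
    exact iSup_congr hscale
  have hfk := feynmanKac_eq_toReal (V := V) (birth₁_pos ha hw) (death₁_nonneg hb hw) hf ht x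
  have hfin : ⨆ n, picard (birth₁ a w) (death₁ b w) (birth₁ a w + death₁ b w + V) f n t x ≠ ⊤ := by
    rw [← lintegral_feynmanKacVar (birth₁_pos ha hw) (death₁_nonneg hb hw) V f ht x]
    exact (integrable_feynmanKacVar hfC hVk ht x).lintegral_lt_top.ne
  constructor
  · intro hQtop
    rw [hQtop, ENNReal.mul_top (by simpa using Real.exp_pos _)] at hsup
    exact ENNReal.mul_ne_top ENNReal.ofReal_ne_top hfin hsup
  · have h1 := congrArg ENNReal.toReal hsup
    rw [ENNReal.toReal_mul, ENNReal.toReal_mul, ENNReal.toReal_ofReal (hw x).le,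
      ENNReal.toReal_ofReal (Real.exp_nonneg _), ← hfk] at h1
    rw [mul_left_comm, h1, ← mul_assoc, ← Real.exp_add]
    simp

/-- First order intertwining for bounded functions: the weighted gradient of the semigroup of a
non-explosive birth-death process is a Feynman-Kac semigroup applied to the gradient. Shifting the
potential by `c` is compensated by the factor `exp (c t)`. -/
lemma grad_semigroup_of_bounded {a b w : ℕ → ℝ} {c k : ℝ} (ha : ∀ x, 0 < a x) (hb₀ : b 0 = 0)
    (hb : ∀ x, 0 ≤ b x) (hne : NonExplosiveRates a b) (hw : ∀ x, 0 < w x)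
    (hV : ∀ x, V x = potential₁ a b w x + c) (hVk : ∀ x, -k ≤ V x)
    {g : ℕ → ℝ} {C C' : ℝ} (hg : ∀ x, |g x| ≤ C) (hgw : ∀ x, |grad w g x| ≤ C')
    {t : ℝ} (ht : 0 ≤ t) (x : ℕ) :
    grad w (semigroup a b t g) x =
      Real.exp (c * t) * feynmanKac (birth₁ a w) (death₁ b w) V t (grad w g) x := by
  have hΔ : ∀ y, |g (y + 1) - g y| ≤ C + C := fun y =>
    (abs_sub _ _).trans (add_le_add (hg _) (hg _))
  have hbdd : ∀ {r : ℕ → ℝ} {K : ℝ}, (∀ y, |r y| ≤ K) → ∀ y, ‖max (r y) 0‖ ≤ K := by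
    intro r K hr y
    rw [Real.norm_eq_abs, abs_of_nonneg (le_max_right _ _)]
    exact max_le ((le_abs_self _).trans (hr y)) ((abs_nonneg _).trans (hr y))
  have hneg : ∀ {r : ℕ → ℝ} {K : ℝ}, (∀ y, |r y| ≤ K) → ∀ y, |-r y| ≤ K := fun hr y => by
    rw [abs_neg]; exact hr y
  set g₁ : ℕ →ᵇ ℝ := .ofNormedAddCommGroupDiscrete (fun y => max (g y) 0) C (hbdd hg)
  set g₂ : ℕ →ᵇ ℝ := .ofNormedAddCommGroupDiscrete (fun y => max (-g y) 0) C (hbdd (hneg hg))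
  set h₁ : ℕ →ᵇ ℝ := .ofNormedAddCommGroupDiscrete (fun y => max (g (y + 1) - g y) 0) (C + C)
    (hbdd hΔ)
  set h₂ : ℕ →ᵇ ℝ := .ofNormedAddCommGroupDiscrete (fun y => max (-(g (y + 1) - g y)) 0) (C + C)
    (hbdd (hneg hΔ))
  have hmax : ∀ r : ℝ, max r 0 - max (-r) 0 = r := fun r => by
    rw [max_zero_sub_eq_self]
  have hwg : ∀ y, w y * grad w g y = g (y + 1) - g y := fun y => mul_div_cancel₀ _ (hw y).ne'
  obtain ⟨hf₁, e₁⟩ := iSup_picard_difference (h := h₁) ha hb₀ hb hw hV hVk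
    (f := fun y => max (grad w g y) 0) (fun y => le_max_right _ _) (hbdd hgw) (fun y => by
      rw [mul_max_of_nonneg _ _ (hw y).le, hwg, mul_zero]; rfl) ht x
  obtain ⟨hf₂, e₂⟩ := iSup_picard_difference (h := h₂) ha hb₀ hb hw hV hVk
    (f := fun y => max (-grad w g y) 0) (fun y => le_max_right _ _) (hbdd (hneg hgw)) (fun y => by
      rw [mul_max_of_nonneg _ _ (hw y).le, mul_neg, hwg, mul_zero]; rfl) ht x
  have key := picard_succ_sub_eq ha hb₀ hb hne (g₁ := g₁) (g₂ := g₂) (h₁ := h₁) (h₂ := h₂)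
    (fun y => le_max_right _ _) (fun y => le_max_right _ _) (fun y => le_max_right _ _)
    (fun y => le_max_right _ _) (fun y => by
      change (max (g (y + 1)) 0 - max (-g (y + 1)) 0) - (max (g y) 0 - max (-g y) 0) =
        max (g (y + 1) - g y) 0 - max (-(g (y + 1) - g y)) 0
      rw [hmax, hmax, hmax]) ht x hf₁ hf₂
  have hS : ∀ y, semigroup a b t g y = (⨆ n, picard a b (a + b) g₁ n t y).toReal -
      (⨆ n, picard a b (a + b) g₂ n t y).toReal := fun y => by
    rw [semigroup_eq_feynmanKac, feynmanKac_eq_sub hg (k := 0) (by simp) ht,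
      feynmanKac_eq_toReal ha hb (fun y => le_max_right _ _) ht,
      feynmanKac_eq_toReal ha hb (fun y => le_max_right _ _) ht, add_zero]
    rfl
  rw [e₁, e₂, ← hS, ← hS] at key
  rw [grad, key, feynmanKac_eq_sub hgw hVk ht, ← mul_sub, ← mul_sub,
    mul_div_cancel_left₀ _ (hw x).ne']

/-! ### Unbounded functions with bounded gradient -/

/-- If the potential `V_u` is a constant `c`, the generator maps `U x = ∑_{z < x} u z` to the
affine function `α 0 * u 0 - c * U` of `U`. -/
lemma generator_sum_range {u : ℕ → ℝ} {c : ℝ} (hu : ∀ x, 0 < u x) (hβ₀ : β 0 = 0)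
    (hVu : ∀ x, potential₁ α β u x = c) (x : ℕ) :
    α x * u x - β x * u (x - 1) = α 0 * u 0 - c * ∑ z ∈ Finset.range x, u z := by
  induction x with
  | zero => simp [hβ₀]
  | succ x ih =>
    have h := hVu x
    have hux := (hu x).ne'
    have h' : α x * u x - u (x + 1) * α (x + 1) + β (x + 1) * u x - β x * u (x - 1) = c * u x := by
      rw [← h, potential₁, birth₁, death₁]
      split_ifs with hx
      · subst hx
        rw [hβ₀]; field_simp
      · field_simp
    rw [Finset.sum_range_succ, Nat.add_sub_cancel]
    linear_combination ih - h'

/-- If `V_u` is constant, a function that grows like `∑_{z < x} u z` is a Lyapunov function, and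
hence integrable for the semigroup. -/
lemma integrable_semigroupVar_sum_range {u : ℕ → ℝ} {c A C : ℝ} (hα : ∀ x, 0 < α x)
    (hβ₀ : β 0 = 0) (hβ : ∀ x, 0 ≤ β x) (hu : ∀ x, 0 < u x)
    (hVu : ∀ x, potential₁ α β u x = c) (hA : 1 ≤ A) (hC : 0 ≤ C) {t : ℝ} (ht : 0 ≤ t) (x : ℕ) :
    Integrable (semigroupVar α β t (fun y => A + C * ∑ z ∈ Finset.range y, u z) x) noise := by
  set W : ℕ → ℝ := fun y => A + C * ∑ z ∈ Finset.range y, u z with hW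
  have hU : ∀ y, 0 ≤ ∑ z ∈ Finset.range y, u z := fun y =>
    Finset.sum_nonneg fun z _ => (hu z).le
  have hW1 : ∀ y, 1 ≤ W y := fun y => by
    have := mul_nonneg hC (hU y)
    simp only [hW]; linarith
  have hL : ∀ y, α y * W (y + 1) + β y * W (y - 1) ≤
      (|c| + C * (α 0 * u 0) + (α + β + 0) y) * W y := by
    intro y
    have hgen := generator_sum_range hu hβ₀ hVu y
    have e : α y * W (y + 1) + β y * W (y - 1) =
        (α y + β y) * W y + C * (α y * u y - β y * u (y - 1)) := by
      rcases y with _ | y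
      · simp [hW, hβ₀]; ring
      · simp only [hW, Finset.sum_range_succ, Nat.add_sub_cancel]; ring
    rw [e, hgen]
    have h0 : 0 ≤ C * (α 0 * u 0) := mul_nonneg hC (mul_pos (hα 0) (hu 0)).le
    have h1 : C * (α 0 * u 0) ≤ C * (α 0 * u 0) * W y := le_mul_of_one_le_right h0 (hW1 y)
    have h2 : -c * (C * ∑ z ∈ Finset.range y, u z) ≤ |c| * W y := by
      refine (mul_le_mul_of_nonneg_right (neg_le_abs c) (mul_nonneg hC (hU y))).trans
        (mul_le_mul_of_nonneg_left ?_ (abs_nonneg c))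
      simp only [hW]; linarith
    simp only [Pi.add_apply, Pi.zero_apply, add_zero]
    linarith
  rw [semigroupVar_eq_feynmanKacVar]
  refine ⟨(measurable_feynmanKacVar 0 W ht x).aestronglyMeasurable, ?_⟩
  rw [hasFiniteIntegral_iff_ofReal (Eventually.of_forall fun ω =>
    feynmanKacVar_nonneg (fun y => zero_le_one.trans (hW1 y)) t x ω),
    lintegral_feynmanKacVar hα hβ 0 W ht x]
  exact lt_of_le_of_lt (iSup_le fun n => picard_le_of_lyapunov (fun y => (hα y).le) hβ
    (fun y => zero_le_one.trans (hW1 y)) (fun y => le_rfl) hL n ht x) ENNReal.ofReal_lt_top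

/-- The semigroups at a fixed time along functions that converge in a dominated way. -/
lemma tendsto_semigroup {t : ℝ} (ht : 0 ≤ t) {x : ℕ} {F : ℕ → ℕ → ℝ} {f G : ℕ → ℝ}
    (hG : Integrable (semigroupVar α β t G x) noise) (hFG : ∀ n y, |F n y| ≤ G y)
    (hF : ∀ y, Tendsto (fun n => F n y) atTop (𝓝 (f y))) :
    Tendsto (fun n => semigroup α β t (F n) x) atTop (𝓝 (semigroup α β t f x)) := by
  refine tendsto_integral_of_dominated_convergence _ (fun n => ?_) hG (fun n => ?_) ?_
  · rw [semigroupVar_eq_feynmanKacVar]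
    exact (measurable_feynmanKacVar 0 (F n) ht x).aestronglyMeasurable
  · refine Eventually.of_forall fun ω => ?_
    rw [semigroupVar, semigroupVar, Real.norm_eq_abs]
    by_cases hω : ω ∈ alive α β x t
    · simpa only [Set.indicator_of_mem hω] using hFG n _
    · simp [Set.indicator_of_notMem hω]
  · refine Eventually.of_forall fun ω => ?_
    simp only [semigroupVar]
    by_cases hω : ω ∈ alive α β x t
    · simpa only [Set.indicator_of_mem hω] using hF _
    · simp [Set.indicator_of_notMem hω]

lemma abs_le_of_abs_grad_le {u f : ℕ → ℝ} {C : ℝ} (hu : ∀ x, 0 < u x)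
    (hf : ∀ x, |grad u f x| ≤ C) (x : ℕ) :
    |f x| ≤ |f 0| + C * ∑ z ∈ Finset.range x, u z := by
  induction x with
  | zero => simp
  | succ x ih =>
    have h1 : |f (x + 1) - f x| ≤ C * u x := by
      have := hf x
      rwa [grad, abs_div, abs_of_pos (hu x), div_le_iff₀ (hu x)] at this
    have h2 : |f (x + 1)| ≤ |f x| + |f (x + 1) - f x| := by
      simpa using abs_add_le (f x) (f (x + 1) - f x)
    rw [Finset.sum_range_succ, mul_add]
    linarith

/-- First order intertwining for a constant potential `V_u`, for functions with bounded gradient.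
The truncations `f (min · n)` are bounded, and their gradients are those of `f`, cut off at `n`. -/
lemma grad_semigroup_of_potential_const {u f : ℕ → ℝ} {c C : ℝ} (hα : ∀ x, 0 < α x)
    (hβ₀ : β 0 = 0) (hβ : ∀ x, 0 ≤ β x) (hne : NonExplosiveRates α β) (hu : ∀ x, 0 < u x)
    (hVu : ∀ x, potential₁ α β u x = c) (hf : ∀ x, |grad u f x| ≤ C)
    {t : ℝ} (ht : 0 ≤ t) :
    (∀ x, Integrable (semigroupVar α β t f x) noise) ∧
    grad u (semigroup α β t f) = fun x =>
      Real.exp (-c * t) * semigroup (birth₁ α u) (death₁ β u) t (grad u f) x := by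
  have hC : 0 ≤ C := (abs_nonneg _).trans (hf 0)
  set G : ℕ → ℝ := fun y => |f 0| + 1 + C * ∑ z ∈ Finset.range y, u z with hG
  have hGint : ∀ x, Integrable (semigroupVar α β t G x) noise := fun x =>
    integrable_semigroupVar_sum_range hα hβ₀ hβ hu hVu
      (le_add_of_nonneg_left (abs_nonneg (f 0))) hC ht x
  have hmono : Monotone fun y => ∑ z ∈ Finset.range y, u z := fun y y' h =>
    Finset.sum_le_sum_of_subset_of_nonneg (Finset.range_mono h) fun z _ _ => (hu z).le
  have hfG : ∀ n y, |f (min y n)| ≤ G y := fun n y => by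
    have h1 := abs_le_of_abs_grad_le hu hf (min y n)
    have h2 := mul_le_mul_of_nonneg_left (hmono (min_le_left y n)) hC
    simp only [hG]
    simp only at h2
    linarith
  refine ⟨fun x => ?_, funext fun x => ?_⟩
  · refine (hGint x).mono' ?_ (Eventually.of_forall fun ω => ?_)
    · rw [semigroupVar_eq_feynmanKacVar]
      exact (measurable_feynmanKacVar 0 f ht x).aestronglyMeasurable
    · rw [semigroupVar, semigroupVar, Real.norm_eq_abs]
      by_cases hω : ω ∈ alive α β x t
      · simpa only [Set.indicator_of_mem hω, min_self] using
          hfG (path α β x t ω) (path α β x t ω)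
      · simp [Set.indicator_of_notMem hω]
  · have hgrad : ∀ n y, grad u (fun z => f (min z n)) y = if y < n then grad u f y else 0 := by
      intro n y
      rw [grad, grad]
      split_ifs with h
      · rw [min_eq_left h.le, min_eq_left (Nat.succ_le_of_lt h)]
      · rw [min_eq_right (not_lt.1 h), min_eq_right ((not_lt.1 h).trans y.le_succ), sub_self,
          zero_div]
    have hgradC : ∀ n y, |grad u (fun z => f (min z n)) y| ≤ C := fun n y => by
      rw [hgrad]
      split_ifs
      exacts [hf y, by simpa using hC]
    have hn : ∀ n, grad u (semigroup α β t fun z => f (min z n)) x = Real.exp (-c * t) *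
        semigroup (birth₁ α u) (death₁ β u) t (grad u fun z => f (min z n)) x := fun n => by
      rw [semigroup_eq_feynmanKac (birth₁ α u)]
      refine grad_semigroup_of_bounded (k := 0) (C := |f 0| + C * ∑ z ∈ Finset.range n, u z)
        hα hβ₀ hβ hne hu (fun y => ?_) (by simp)
        (fun y => (abs_le_of_abs_grad_le hu hf (min y n)).trans ?_) (hgradC n) ht x
      · rw [hVu]; simp
      · have := mul_le_mul_of_nonneg_left (hmono (min_le_right y n)) hC
        simpa using this
    have hl : ∀ y, Tendsto (fun n => semigroup α β t (fun z => f (min z n)) y) atTop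
        (𝓝 (semigroup α β t f y)) := fun y =>
      tendsto_semigroup ht (hGint y) hfG fun z => tendsto_const_nhds.congr' (by
        filter_upwards [eventually_ge_atTop z] with n hn
        rw [min_eq_left hn])
    have hr : Tendsto (fun n => semigroup (birth₁ α u) (death₁ β u) t
        (grad u fun z => f (min z n)) x) atTop
        (𝓝 (semigroup (birth₁ α u) (death₁ β u) t (grad u f) x)) := by
      refine tendsto_semigroup (G := fun _ => C) ht ?_ hgradC fun z =>
        tendsto_const_nhds.congr' ?_
      · rw [semigroupVar_eq_feynmanKacVar]
        exact integrable_feynmanKacVar (k := 0) (fun _ => (abs_of_nonneg hC).le) (by simp)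
          ht x
      · filter_upwards [eventually_gt_atTop z] with n hn
        rw [hgrad, if_pos hn]
    exact tendsto_nhds_unique (((hl (x + 1)).sub (hl x)).div_const (u x))
      ((hr.const_mul (Real.exp (-c * t))).congr fun n => (hn n).symm)

/-! ### Second order rates as iterated first order rates -/

lemma birth₁_birth₁ (α u v : ℕ → ℝ) : birth₁ (birth₁ α u) v = birth₂ α u v := by
  ext x
  rw [birth₁, birth₁, birth₂, mul_assoc]

lemma death₁_death₁ (β u v : ℕ → ℝ) : death₁ (death₁ β u) v = death₂ β u v := by
  ext x
  rw [death₁, death₁, death₂]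
  split_ifs
  exacts [rfl, (mul_assoc _ _ _).symm]

lemma potential₂_eq (α β u v : ℕ → ℝ) (x : ℕ) :
    potential₂ α β u v x =
      potential₁ (birth₁ α u) (death₁ β u) v x + potential₁ α β u x := by
  rw [potential₂, potential₁, potential₁, birth₁_birth₁, death₁_death₁]
  simp only [birth₁, birth₂, death₁, death₂, Nat.succ_ne_zero, if_false, Nat.add_sub_cancel]
  split_ifs <;> ring

end Intertwining

end BirthDeath

theorem theorem3 (α β u v : ℕ → ℝ)
    (hα : ∀ x, 0 < α x) (hβ₀ : β 0 = 0) (hβ : ∀ x, 1 ≤ x → 0 < β x)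
    (hu : ∀ x, 0 < u x) (hv : ∀ x, 0 < v x)
    (hergodic : BirthDeath.ErgodicRates α β)
    (hnonexpl : BirthDeath.NonExplosiveRates α β)
    (hnonexpl_u : BirthDeath.NonExplosiveRates (BirthDeath.birth₁ α u) (BirthDeath.death₁ β u))
    (hVu : ∃ c : ℝ, ∀ x, BirthDeath.potential₁ α β u x = c)
    (hVuv : BddBelow (Set.range (BirthDeath.potential₂ α β u v)))
    (f : ℕ → ℝ)
    (hf₁ : BddAbove (Set.range fun x => |BirthDeath.grad u f x|))
    (hf₂ : BddAbove (Set.range fun x => |BirthDeath.grad v (BirthDeath.grad u f) x|))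
    (t : ℝ) (ht : 0 ≤ t) :
    (∀ x, MeasureTheory.Integrable (BirthDeath.semigroupVar α β t f x) BirthDeath.noise) ∧
    (∀ x, MeasureTheory.Integrable
      (BirthDeath.feynmanKacVar (BirthDeath.birth₂ α u v) (BirthDeath.death₂ β u v)
        (BirthDeath.potential₂ α β u v) t (BirthDeath.grad v (BirthDeath.grad u f)) x)
      BirthDeath.noise) ∧
    BirthDeath.grad v (BirthDeath.grad u (BirthDeath.semigroup α β t f)) =
      BirthDeath.feynmanKac (BirthDeath.birth₂ α u v) (BirthDeath.death₂ β u v)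
        (BirthDeath.potential₂ α β u v) t (BirthDeath.grad v (BirthDeath.grad u f)) := by
  open BirthDeath in
  obtain ⟨c, hc⟩ := hVu
  obtain ⟨C₁, hC₁⟩ := hf₁
  obtain ⟨C₂, hC₂⟩ := hf₂
  obtain ⟨k, hk⟩ := hVuv
  have hf₁' : ∀ x, |grad u f x| ≤ C₁ := fun x => hC₁ ⟨x, rfl⟩
  have hf₂' : ∀ x, |grad v (grad u f) x| ≤ C₂ := fun x => hC₂ ⟨x, rfl⟩
  have hβ' : ∀ x, 0 ≤ β x := fun x => by
    rcases x with _ | x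
    exacts [hβ₀.ge, (hβ _ x.succ_pos).le]
  have hVk : ∀ x, -(-k) ≤ potential₂ α β u v x := fun x => (neg_neg k).trans_le (hk ⟨x, rfl⟩)
  obtain ⟨hint, h₁⟩ := grad_semigroup_of_potential_const hα hβ₀ hβ' hnonexpl hu hc hf₁' ht
  refine ⟨hint, fun x => integrable_feynmanKacVar hf₂' hVk ht x, funext fun x => ?_⟩
  have h₂ := grad_semigroup_of_bounded (V := potential₂ α β u v) (c := c) (birth₁_pos hα hu)
    (by simp [death₁]) (death₁_nonneg hβ' hu) hnonexpl_u hv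
    (fun y => by rw [potential₂_eq, hc]) hVk hf₁' hf₂' ht x
  rw [birth₁_birth₁, death₁_death₁] at h₂
  rw [h₁, grad, ← mul_sub, mul_div_assoc]
  rw [grad] at h₂
  rw [h₂, ← mul_assoc, ← Real.exp_add]
  simp
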